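/- **Setting.** Let $\rho_1,\rho_2,\sigma,\varepsilon,M_0,c_0>0$, $\eta_1,\eta_2\in\mathbb R$, and put $\rho(c)=\rho_1\hat c+\rho_2(1-\hat c)$ with $\hat c=\min(\max(c,0),1)$, $\eta(c)=\eta_1c+\eta_2(1-c)$, $f_0(c)=\frac{12\sigma}{\varepsilon}c^2(1-c)^2$, $\rho_0=\max(\rho_1,\rho_2)$. The state is $\mathbf Q=(C,\sqrt\rho\,\vec U,P)$ with $\rho=\rho(C)$, the entropy variables are $\mathbf W=(\mu,\vec U,P/(\rho_0c_0^2))$, the mass matrix is $\mathsf M=\mathrm{diag}(1,\sqrt\rho,\sqrt\rho,\sqrt\rho,1)$. In direction $d$ the inviscid flux is $(CU_d,\ (\tfrac12\rho U_dU_i+\delta_{di}P)_{i=1}^3,\ 0)$; the non-conservative terms are $\sum_m\Phi_m\cdot\nabla W_m=(0,\tfrac12\rho\vec U\cdot\nabla\vec U+C\nabla\mu,\rho_0c_0^2\nabla\cdot\vec U)$; for a block vector $\mathbf G=(\vec G_\mu,\vec G_{\vec u},\vec G_p)$ the viscous flux in direction $d$ is $(M_0G_{\mu,d},(2\eta\mathcal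 S_{di})_{i},0)$ with $\mathcal S$ the symmetric part of $\vec G_{\vec u}$. **Mesh.** Consider a finite conforming unstructured mesh of curvilinear hexahedra of order $N\ge1$, each given by its nodal coordinates $\mathcal X$ at the tensor-product Gauss--Lobatto nodes of $E=[-1,1]^3$, with Jacobian $\mathcal J=\vec a_1\cdot(\vec a_2\times\vec a_3)>0$ at the nodes ($\vec a_i=\partial\mathcal X/\partial\xi^i$) and metric terms $\mathcal J\vec a^i$ computed in curl form, $\mathcal Ja^i_n=-\hat\xi_i\cdot\nabla_\xi\times\mathbb I^N(\mathcal X_l\nabla_\xi\mathcal X_m)$, $(n,m,l)$ cyclic. Each element side is either the left or the right side of exactly one interior face, or a physical boundary face; the two sides of an interior face have the same nodes in space, up to one of the eight symmetries of the square, and the two elements lie on opposite sides of it. $\langle\cdot,\cdot\rangle_{E,N}$, $\int_{\partial e,N}$ and $\int_{f,N}$ denote Gauss--Lobatto quadratures (surface weights $|\mathcal J\vec a^i|$, outward unit normal $\vec n$), and a tilde denotes contravariant components $\tilde F^i=\mathcal J\vec a^i\cdot F$. **Scheme.** On $[0,T]$, $T>0$, let $\mathbf Q$ (differentiable in time), $\mu,\mathbf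 G,\vec G_c$ be elementwise polynomials of degree $\le N$ in each variable such that at every time, on every element and for all polynomial test functions of that degree $$\langle\mathcal J\mathsf M\mathbf Q_t,\varphi_q\rangle_{E,N}+\int_{\partial e,N}\varphi_q^T\Big(\mathbf F_e^\star-\mathbf F_e+\sum_m\big((\Phi_mW_m)^\diamondsuit-\Phi_mW_m\big)\Big)\cdot\vec n\,dS+\langle\varphi_q,\nabla_\xi\cdot\tilde{\mathbf F}_e\rangle_{E,N}+\sum_m\langle\varphi_q,\tilde\Phi_m\cdot\nabla_\xi W_m\rangle_{E,N}=\int_{\partial e,N}\varphi_q^T\mathbf F_v^\star\cdot\vec n\,dS-\langle\tilde{\mathbf F}_v,\nabla_\xi\varphi_q\rangle_{E,N},$$ $$\langle\mathcal J\mathbf G,\varphi_g\rangle_{E,N}=\int_{\partial e,N}(\mathbf W^\star-\mathbf W)^T(\varphi_g\cdot\vec n)\,dS+\langle\tilde\varphi_g,\nabla_\xi\mathbf W\rangle_{E,N},$$ $$\langle\mathcal J\mu,\varphi_\mu\rangle_{E,N}=\langle\mathcal Jf_0'(C),\varphi_\mu\rangle_{E,N}-\int_{\partial e,N}\tfrac32\sigma\varepsilon\,\varphi_\mu\vec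 G_c^\star\cdot\vec n\,dS+\langle\tfrac32\sigma\varepsilon\tilde{\vec G}_c,\nabla_\xi\varphi_\mu\rangle_{E,N},$$ $$\langle\mathcal J\vec G_c,\vec\varphi_c\rangle_{E,N}=\int_{\partial e,N}(C^\star-C)\,\vec\varphi_c\cdot\vec n\,dS+\langle\tilde{\vec\varphi}_c,\nabla_\xi C\rangle_{E,N}$$ (no source terms). *Interior faces.* With $\{\!\{\cdot\}\!\}$ the average, $[\![\cdot]\!]=(\cdot)_R-(\cdot)_L$ and $\vec n_L$ the left outward normal: $\mathbf W^\star=\{\!\{\mathbf W\}\!\}$, $C^\star=\{\!\{C\}\!\}$, $\mathbf F_v^\star\cdot\vec n_L=\{\!\{\mathbf F_v\}\!\}\cdot\vec n_L+\beta[\![\mu]\!]\mathbf e_1$, $\vec G_c^\star\cdot\vec n_L=\{\!\{\vec G_c\}\!\}\cdot\vec n_L+\beta[\![C]\!]$ (Bassi--Rebay 1), where $\beta\ge0$ is any time-independent function on the nodes of the interior faces. The inviscid fluxes are either *central*, $\mathbf F_e^\star=\{\!\{\mathbf F_e\}\!\}$, $(\Phi_mW_m)^\diamondsuit=\Phi_m\{\!\{W_m\}\!\}$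 with $\Phi_m$ the local value, or those of the *exact Riemann solver*: with $\vec n=\vec n_L$, $U_n=\vec U\cdot\vec n$, $\vec V_t=\vec U-U_n\vec n$, $a=\sqrt{U_n^2+4\rho_0c_0^2/\rho}$, $\lambda^\pm=(U_n\pm a)/2$, $$U_n^\star=\frac{P_L-P_R+\rho_LU_{nL}\lambda_L^+-\rho_RU_{nR}\lambda_R^-}{\rho_L\lambda_L^+-\rho_R\lambda_R^-},\qquad P^\star=P_L+\rho_L\lambda_L^+(U_{nL}-U_n^\star),$$ $(\rho^\star,\vec V_t^\star)=\big(\frac{\rho_L\lambda_L^+}{U_n^\star-\lambda_L^-},\vec V_{tL}\big)$ if $U_n^\star\ge0$ and $\big(\frac{\rho_R\lambda_R^-}{U_n^\star-\lambda_R^+},\vec V_{tR}\big)$ otherwise, $\mathbf F_e^\star\cdot\vec n=(\{\!\{CU_n\}\!\},(\tfrac12\rho^\star U_n^{\star2}+P^\star)\vec n+\tfrac12\rho^\star U_n^\star\vec V_t^\star,0)$ and $$\sum_m(\Phi_mW_m)^\diamondsuit\cdot\vec n=\big(0,\ \tfrac12\rho^\star U_n^\star(U_n^\star\vec n+\vec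 V_t^\star)+\tfrac12\rho U_n\vec U-\tfrac12\rho^\star U_n^\star\vec U+C\{\!\{\mu\}\!\}\vec n,\ \rho_0c_0^2U_n^\star\big)$$ with unstarred quantities local to the element. For the right element these normal fluxes change sign. *Physical boundary.* Each boundary face is a free-slip or a no-slip wall. The inviscid fluxes are the central or exact-Riemann ones (the same kind at all walls) between the interior state and the ghost state with reversed normal velocity and the same $C,\vec V_t,P,\mu$; $C^\star=C$ and $-\tfrac32\sigma\varepsilon\,\vec G_c^\star\cdot\vec n=f_w'(C)$ for a differentiable surface free energy $f_w$. At a free-slip wall $\mathbf W^\star=\mathbf W$, $\mathbf F_v^\star\cdot\vec n=0$; at a no-slip wall $\mathbf W^\star=(\mu,0,0,0,W_5)$, $\mathbf F_v^\star\cdot\vec n=(0,2\eta\mathcal S\vec n,0)$. **Claim.** Let $$\bar{\mathcal E}^\beta=\sum_e\Big\langle\mathcal J\Big(f_0(C)+\tfrac34\sigma\varepsilon|\vec G_c|^2+\tfrac12\rho|\vec U|^2+\tfrac{P^2}{2\rho_0c_0^2}\Big),1\Big\rangle_{E,N}+\tfrac34\sigma\varepsilon\sum_{\text{interior }f}\int_{f,N}\beta[\![C]\!]^2\,dS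 .$$ Then $\bar{\mathcal E}^\beta+\sum_{\text{boundary }f}\int_{f,N}f_w(C)\,dS$ is differentiable on $[0,T]$ (one-sidedly at the end points), and $$\frac{d}{dt}\Big(\bar{\mathcal E}^\beta+\sum_{\text{boundary }f}\int_{f,N}f_w(C)\,dS\Big)\le-\sum_e\big\langle\mathcal J\big(M_0|\vec G_\mu|^2+2\eta\,\mathcal S:\mathcal S\big),1\big\rangle_{E,N},$$ with equality if the inviscid fluxes are central at all faces and $\beta=0$. Moreover $\bar{\mathcal E}^\beta\ge0$, and if $\eta(C)\ge0$ at all nodes and times, then $\bar{\mathcal E}^\beta+\sum_{\text{boundary }f}\int_{f,N}f_w(C)\,dS$ never exceeds its value at $t=0$. -/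

import Mathlib

open Set

namespace INSCH

noncomputable section

/-! ## Gauss-Lobatto quadrature and nodal polynomial calculus on the reference cube -/

/-- The `(N+1)`-point Gauss-Lobatto rule on `[-1,1]`: increasing nodes that contain both end points
and weights such that the rule has the maximal degree of exactness `2N-1`. These conditions determine
nodes and weights uniquely. There is no such rule for `N = 0`. -/
structure GaussLobatto (N : ℕ) where
  node : Fin (N + 1) → ℝ
  weight : Fin (N + 1) → ℝ
  strictMono_node : StrictMono node
  node_first : node 0 = -1
  node_last : node (Fin.last N) = 1
  exact_of_degree : ∀ p : Polynomial ℝ, p.natDegree < 2 * N →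
    ∑ i, weight i * p.eval (node i) = ∫ x in (-1 : ℝ)..1, p.eval x

/-- Multi-index of a tensor-product node of the reference cube. A function `Node N → ℝ` is
identified with the polynomial of degree at most `N` in each variable having these nodal values. -/
abbrev Node (N : ℕ) := Fin 3 → Fin (N + 1)

/-- Index of a node on a face: positions along the two tangential reference directions. -/
abbrev FaceNode (N : ℕ) := Fin (N + 1) × Fin (N + 1)

/-- A side of the reference cube: the coordinate direction it is orthogonal to, and whether that
coordinate is `+1` (`true`) or `-1` (`false`) on it. -/
abbrev Side := Fin 3 × Bool

/-- The sign of the outward reference normal of a side. -/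
def sideSign (s : Side) : ℝ := if s.2 then 1 else -1

variable {N : ℕ}

/-- The volume node that sits at a node of a side; the tangential directions of a side orthogonal to
direction `i` are, in this order, `i + 1` and `i + 2` modulo 3. -/
def faceNode (s : Side) (a : FaceNode N) : Node N := fun d =>
  if d = s.1 then (if s.2 then Fin.last N else 0) else if d = s.1 + 1 then a.1 else a.2

/-- The derivative matrix `D i j = l_j'(ξ_i)` of the Lagrange polynomials. -/
def derivMatrix (gl : GaussLobatto N) (i j : Fin (N + 1)) : ℝ :=
  (Polynomial.derivative (Lagrange.basis Finset.univ gl.node j)).eval (gl.node i)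

/-- Nodal values of the derivative of a nodal polynomial in reference direction `d`. -/
def refDeriv (gl : GaussLobatto N) (d : Fin 3) (f : Node N → ℝ) (ν : Node N) : ℝ :=
  ∑ m, derivMatrix gl (ν d) m * f (Function.update ν d m)

/-- Quadrature on the reference cube. -/
def volQuad (gl : GaussLobatto N) (f : Node N → ℝ) : ℝ :=
  ∑ ν : Node N, gl.weight (ν 0) * gl.weight (ν 1) * gl.weight (ν 2) * f ν

/-- Quadrature on a side of the reference cube. -/
def faceQuad (gl : GaussLobatto N) (f : FaceNode N → ℝ) : ℝ :=
  ∑ a : FaceNode N, gl.weight a.1 * gl.weight a.2 * f a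

/-! ## Curvilinear geometry. `X ν n` is the `n`-th Cartesian coordinate of the node `ν`. -/

/-- Covariant basis vectors of the interpolated mapping. -/
def covariantBasis (gl : GaussLobatto N) (X : Node N → Fin 3 → ℝ) (ν : Node N) (i : Fin 3) :
    Fin 3 → ℝ :=
  fun n => refDeriv gl i (fun κ => X κ n) ν

/-- The Jacobian `a₁ · (a₂ × a₃)` of the interpolated mapping at a node. -/
def jacobian (gl : GaussLobatto N) (X : Node N → Fin 3 → ℝ) (ν : Node N) : ℝ :=
  dotProduct (covariantBasis gl X ν 0)
    (crossProduct (covariantBasis gl X ν 1) (covariantBasis gl X ν 2))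

/-- The volume-weighted contravariant vectors in curl form: the `n`-th Cartesian component of
`J aⁱ` is minus the `i`-th component of the reference curl of the interpolant of `X_l ∇ X_m`,
with `(n, m, l)` cyclic. -/
def metric (gl : GaussLobatto N) (X : Node N → Fin 3 → ℝ) (ν : Node N) (i n : Fin 3) : ℝ :=
  -(refDeriv gl (i + 1)
        (fun κ => X κ (n + 2) * refDeriv gl (i + 2) (fun κ' => X κ' (n + 1)) κ) ν
    - refDeriv gl (i + 2)
        (fun κ => X κ (n + 2) * refDeriv gl (i + 1) (fun κ' => X κ' (n + 1)) κ) ν)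

/-- The surface Jacobian `|J aⁱ|` at a node of a side. -/
def faceJacobian (gl : GaussLobatto N) (X : Node N → Fin 3 → ℝ) (s : Side) (a : FaceNode N) : ℝ :=
  Real.sqrt (∑ n, metric gl X (faceNode s a) s.1 n ^ 2)

/-- The outward unit normal at a node of a side. -/
def outwardNormal (gl : GaussLobatto N) (X : Node N → Fin 3 → ℝ) (s : Side) (a : FaceNode N) :
    Fin 3 → ℝ :=
  fun n => sideSign s * metric gl X (faceNode s a) s.1 n / faceJacobian gl X s a

/-- One of the eight ways in which the squares parametrizing two adjacent sides can be identified: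
reverse the first and/or the second coordinate, then possibly interchange them. -/
structure FaceOrientation where
  flip₁ : Bool
  flip₂ : Bool
  swap : Bool

/-- The identification of face nodes that belongs to an orientation. -/
def FaceOrientation.nodeEquiv (o : FaceOrientation) (N : ℕ) : FaceNode N ≃ FaceNode N :=
  (Equiv.prodCongr (if o.flip₁ then Fin.revPerm else Equiv.refl _)
    (if o.flip₂ then Fin.revPerm else Equiv.refl _)).trans
    (if o.swap then Equiv.prodComm _ _ else Equiv.refl _)

/-- The determinant of the identification of the two squares. -/
def FaceOrientation.det (o : FaceOrientation) : ℝ :=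
  (if o.flip₁ then -1 else 1) * (if o.flip₂ then -1 else 1) * (if o.swap then -1 else 1)

/-- A conforming unstructured mesh of curvilinear hexahedra of order `N`, with elements `Elem`,
interior faces `IFace` and physical boundary faces `BFace`. -/
structure HexMesh (gl : GaussLobatto N) (Elem IFace BFace : Type*) where
  /-- Nodal coordinates: the values of the element mapping at the Gauss-Lobatto nodes. -/
  coord : Elem → Node N → Fin 3 → ℝ
  /-- The mappings preserve orientation and are regular at the nodes. -/
  jacobian_pos : ∀ e ν, 0 < jacobian gl (coord e) ν
  /-- Every side of every element is exactly one of: the left side of one interior face, the right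
  side of one interior face, one physical boundary face. -/
  side : (IFace ⊕ IFace) ⊕ BFace ≃ Elem × Side
  /-- How the right side of an interior face is glued to its left side. -/
  orient : IFace → FaceOrientation
  /-- The two sides of an interior face have the same nodes in space. -/
  conforming : ∀ (f : IFace) (a : FaceNode N),
    coord (side (.inl (.inr f))).1
        (faceNode (side (.inl (.inr f))).2 ((orient f).nodeEquiv N a)) =
      coord (side (.inl (.inl f))).1 (faceNode (side (.inl (.inl f))).2 a)
  /-- The two (positively oriented) elements lie on opposite sides of an interior face: the gluing
  reverses the orientations which the face inherits as part of the two element boundaries. -/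
  opposite : ∀ f : IFace, sideSign (side (.inl (.inl f))).2 * sideSign (side (.inl (.inr f))).2 *
    (orient f).det = -1

/-! ## The physical model -/

/-- Physical parameters: densities, interface tension, interface width, mobility, artificial sound
speed and viscosities of the two fluids. -/
structure Params where
  ρ₁ : ℝ
  ρ₂ : ℝ
  σ : ℝ
  ε : ℝ
  M₀ : ℝ
  c₀ : ℝ
  η₁ : ℝ
  η₂ : ℝ
  ρ₁_pos : 0 < ρ₁
  ρ₂_pos : 0 < ρ₂
  σ_pos : 0 < σ
  ε_pos : 0 < ε
  M₀_pos : 0 < M₀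
  c₀_pos : 0 < c₀

variable (prm : Params)

/-- The density, with the concentration cut off to `[0,1]`. -/
def density (c : ℝ) : ℝ := prm.ρ₁ * min (max c 0) 1 + prm.ρ₂ * (1 - min (max c 0) 1)

/-- The viscosity. -/
def viscosity (c : ℝ) : ℝ := prm.η₁ * c + prm.η₂ * (1 - c)

/-- The chemical free energy. -/
def freeEnergy (c : ℝ) : ℝ := 12 * prm.σ / prm.ε * c ^ 2 * (1 - c) ^ 2

/-- The artificial compressibility modulus `ρ₀ c₀²` with `ρ₀ = max ρ₁ ρ₂`. -/
def acModulus : ℝ := max prm.ρ₁ prm.ρ₂ * prm.c₀ ^ 2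

/-- The discrete unknowns at one node: the state vector `Q = (C, √ρ U, P)`, the chemical potential,
the gradients `G d m` (direction `d`) of the entropy variables `W m`, and the concentration
gradient. -/
structure NodalData where
  Q : Fin 5 → ℝ
  μ : ℝ
  G : Fin 3 → Fin 5 → ℝ
  Gc : Fin 3 → ℝ

/-- The vector with one scalar, three spatial and one scalar component. -/
def mkState (a : ℝ) (v : Fin 3 → ℝ) (b : ℝ) : Fin 5 → ℝ := ![a, v 0, v 1, v 2, b]

/-- Position of the `i`-th spatial component in a state vector. -/
def spIdx (i : Fin 3) : Fin 5 := i.castSucc.succ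

namespace NodalData

variable (x : NodalData)

/-- Concentration. -/
def C : ℝ := x.Q 0

/-- Pressure. -/
def P : ℝ := x.Q 4

/-- Density. -/
def rho : ℝ := density prm x.C

/-- Velocity. -/
def U (i : Fin 3) : ℝ := x.Q (spIdx i) / Real.sqrt (x.rho prm)

/-- Entropy variables `(μ, U, P / (ρ₀ c₀²))`. -/
def W : Fin 5 → ℝ := mkState x.μ (x.U prm) (x.P / acModulus prm)

/-- Diagonal of the mass matrix. -/
def mass : Fin 5 → ℝ := mkState 1 (fun _ => Real.sqrt (x.rho prm)) 1

/-- Inviscid flux in direction `d`. -/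
def Fe (d : Fin 3) : Fin 5 → ℝ :=
  mkState (x.C * x.U prm d)
    (fun i => 1 / 2 * x.rho prm * x.U prm d * x.U prm i + if d = i then x.P else 0) 0

/-- Coefficients of the non-conservative terms: `Phi m d` is the coefficient of the derivative of
`W m` in direction `d`. -/
def Phi : Fin 5 → Fin 3 → Fin 5 → ℝ :=
  ![fun d => mkState 0 (Pi.single d x.C) 0,
    fun d => mkState 0 (Pi.single 0 (1 / 2 * x.rho prm * x.U prm d))
      (if d = 0 then acModulus prm else 0),
    fun d => mkState 0 (Pi.single 1 (1 / 2 * x.rho prm * x.U prm d))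
      (if d = 1 then acModulus prm else 0),
    fun d => mkState 0 (Pi.single 2 (1 / 2 * x.rho prm * x.U prm d))
      (if d = 2 then acModulus prm else 0),
    fun _ => 0]

/-- Strain tensor computed from the discrete velocity gradient. -/
def strain (i j : Fin 3) : ℝ := 1 / 2 * (x.G i (spIdx j) + x.G j (spIdx i))

/-- Viscous flux in direction `d`. -/
def Fv (d : Fin 3) : Fin 5 → ℝ :=
  mkState (prm.M₀ * x.G d 0) (fun i => 2 * viscosity prm x.C * x.strain d i) 0

/-- Normal velocity. -/
def Un (n : Fin 3 → ℝ) : ℝ := ∑ i, x.U prm i * n i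

/-- Tangential velocity vector, `V_{t1} t₁ + V_{t2} t₂` for any orthonormal frame `n, t₁, t₂`. -/
def Vt (n : Fin 3 → ℝ) (i : Fin 3) : ℝ := x.U prm i - x.Un prm n * n i

/-- Mirrored ghost state at a wall: the normal velocity is reversed. -/
def ghost (n : Fin 3 → ℝ) : NodalData where
  Q := mkState (x.Q 0)
    (fun i => x.Q (spIdx i) - 2 * (∑ j, x.Q (spIdx j) * n j) * n i) (x.Q 4)
  μ := x.μ
  G := x.G
  Gc := x.Gc

/-- Pointwise entropy: free energy, kinetic energy and artificial compressibility energy. -/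
def entropy : ℝ :=
  (freeEnergy prm x.C + 3 / 4 * prm.σ * prm.ε * ∑ d, x.Gc d ^ 2)
    + 1 / 2 * x.rho prm * ∑ i, x.U prm i ^ 2 + x.P ^ 2 / (2 * acModulus prm)

/-- Pointwise chemical-potential and viscous dissipation `M₀ |G_μ|² + 2 η S : S`. -/
def dissipation : ℝ :=
  prm.M₀ * ∑ d, x.G d 0 ^ 2 + 2 * viscosity prm x.C * ∑ i, ∑ j, x.strain i j ^ 2

end NodalData

/-! ## Numerical fluxes. All normal fluxes at an interior face refer to the left normal `n`. -/

/-- Normal component of a block vector. -/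
def dotNormal (n : Fin 3 → ℝ) (F : Fin 3 → Fin 5 → ℝ) : Fin 5 → ℝ := ∑ d, n d • F d

/-- The choice of the inviscid numerical flux. -/
inductive InviscidFlux where
  | central
  | exactRiemann

/-- Wall boundary conditions. -/
inductive WallType where
  | freeSlip
  | noSlip

/-- `a = √(U_n² + 4 ρ₀ c₀² / ρ)`. -/
def soundSpeed (x : NodalData) (n : Fin 3 → ℝ) : ℝ :=
  Real.sqrt (x.Un prm n ^ 2 + 4 * acModulus prm / x.rho prm)

/-- `λ⁺ = (U_n + a) / 2`. -/
def lamPlus (x : NodalData) (n : Fin 3 → ℝ) : ℝ := (x.Un prm n + soundSpeed prm x n) / 2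

/-- `λ⁻ = (U_n - a) / 2`. -/
def lamMinus (x : NodalData) (n : Fin 3 → ℝ) : ℝ := (x.Un prm n - soundSpeed prm x n) / 2

/-- Star-region normal velocity of the exact Riemann solution. -/
def starU (L R : NodalData) (n : Fin 3 → ℝ) : ℝ :=
  (L.P - R.P + L.rho prm * L.Un prm n * lamPlus prm L n - R.rho prm * R.Un prm n * lamMinus prm R n)
    / (L.rho prm * lamPlus prm L n - R.rho prm * lamMinus prm R n)

/-- Star-region pressure. -/
def starP (L R : NodalData) (n : Fin 3 → ℝ) : ℝ :=
  L.P + L.rho prm * lamPlus prm L n * (L.Un prm n - starU prm L R n)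

open Classical in
/-- Star-region density. -/
def starRho (L R : NodalData) (n : Fin 3 → ℝ) : ℝ :=
  if 0 ≤ starU prm L R n then
    L.rho prm * lamPlus prm L n / (starU prm L R n - lamMinus prm L n)
  else
    R.rho prm * lamMinus prm R n / (starU prm L R n - lamPlus prm R n)

open Classical in
/-- Star-region tangential velocity vector. -/
def starVt (L R : NodalData) (n : Fin 3 → ℝ) : Fin 3 → ℝ :=
  if 0 ≤ starU prm L R n then L.Vt prm n else R.Vt prm n

/-- Normal inviscid numerical flux `F_e^⋆ · n`. -/
def inviscidStar (k : InviscidFlux) (L R : NodalData) (n : Fin 3 → ℝ) : Fin 5 → ℝ :=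
  match k with
  | .central => (1 / 2 : ℝ) • (dotNormal n (L.Fe prm) + dotNormal n (R.Fe prm))
  | .exactRiemann =>
      mkState ((L.C * L.Un prm n + R.C * R.Un prm n) / 2)
        (fun i => (1 / 2 * starRho prm L R n * starU prm L R n ^ 2 + starP prm L R n) * n i
          + 1 / 2 * starRho prm L R n * starU prm L R n * starVt prm L R n i) 0

/-- Normal diamond flux `∑ₘ (Φₘ Wₘ)^◇ · n`, as seen from the element with the local state `x`, which
is `L` or `R`. -/
def diamondFlux (k : InviscidFlux) (L R x : NodalData) (n : Fin 3 → ℝ) : Fin 5 → ℝ :=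
  match k with
  | .central => ∑ m, ((L.W prm m + R.W prm m) / 2) • dotNormal n (x.Phi prm m)
  | .exactRiemann =>
      mkState 0
        (fun i => 1 / 2 * starRho prm L R n * starU prm L R n
              * (starU prm L R n * n i + starVt prm L R n i)
            + 1 / 2 * x.rho prm * x.Un prm n * x.U prm i
            - 1 / 2 * starRho prm L R n * starU prm L R n * x.U prm i
            + x.C * ((L.μ + R.μ) / 2) * n i)
        (acModulus prm * starU prm L R n)

/-- The numerical values used by an element at a node of one of its sides; normal components refer
to the outward normal of the element. -/
structure NumericalTrace where
  FeN : Fin 5 → ℝ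
  diamondN : Fin 5 → ℝ
  FvN : Fin 5 → ℝ
  W : Fin 5 → ℝ
  GcN : ℝ
  C : ℝ

/-- Interface viscous flux (Bassi-Rebay 1 with penalty `β`), `F_v^⋆ · n`. -/
def viscousStar (β : ℝ) (L R : NodalData) (n : Fin 3 → ℝ) : Fin 5 → ℝ :=
  (1 / 2 : ℝ) • (dotNormal n (L.Fv prm) + dotNormal n (R.Fv prm)) + mkState (β * (R.μ - L.μ)) 0 0

/-- Interface concentration gradient (Bassi-Rebay 1 with penalty `β`), `G_c^⋆ · n`. -/
def gradCStar (β : ℝ) (L R : NodalData) (n : Fin 3 → ℝ) : ℝ :=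
  ∑ d, (L.Gc d + R.Gc d) / 2 * n d + β * (R.C - L.C)

/-- Numerical values at an interior face for the left element. -/
def leftTrace (k : InviscidFlux) (β : ℝ) (L R : NodalData) (n : Fin 3 → ℝ) : NumericalTrace where
  FeN := inviscidStar prm k L R n
  diamondN := diamondFlux prm k L R L n
  FvN := viscousStar prm β L R n
  W := (1 / 2 : ℝ) • (L.W prm + R.W prm)
  GcN := gradCStar β L R n
  C := (L.C + R.C) / 2

/-- Numerical values at an interior face for the right element, whose outward normal is `-n`. -/
def rightTrace (k : InviscidFlux) (β : ℝ) (L R : NodalData) (n : Fin 3 → ℝ) : NumericalTrace where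
  FeN := -inviscidStar prm k L R n
  diamondN := -diamondFlux prm k L R R n
  FvN := -viscousStar prm β L R n
  W := (1 / 2 : ℝ) • (L.W prm + R.W prm)
  GcN := -gradCStar β L R n
  C := (L.C + R.C) / 2

/-- Numerical values at a wall with outward normal `n` and surface free energy `fw`. The inviscid
fluxes are those of the interior state and its mirrored ghost state; the concentration gradient
satisfies `-(3/2) σ ε G_c^⋆ · n = fw'(C)`. -/
def wallTrace (k : InviscidFlux) (b : WallType) (fw : ℝ → ℝ) (x : NodalData) (n : Fin 3 → ℝ) :
    NumericalTrace where
  FeN := inviscidStar prm k x (x.ghost n) n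
  diamondN := diamondFlux prm k x (x.ghost n) x n
  FvN := match b with
    | .freeSlip => 0
    | .noSlip => mkState 0
        (fun i => ∑ d, 2 * viscosity prm x.C * x.strain d i * n d) 0
  W := match b with
    | .freeSlip => x.W prm
    | .noSlip => mkState x.μ 0 (x.P / acModulus prm)
  GcN := -(deriv fw x.C) / (3 / 2 * prm.σ * prm.ε)
  C := x.C

/-! ## The semi-discrete scheme -/

/-- The data of a scheme on a mesh: physical parameters, inviscid fluxes at interior faces and at
walls, the penalty parameter at the nodes of the interior faces (indexed from the left), the type of
each wall, and the surface free energy. -/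
structure Scheme (N : ℕ) (IFace BFace : Type*) where
  prm : Params
  interiorFlux : InviscidFlux
  wallFlux : InviscidFlux
  β : IFace → FaceNode N → ℝ
  wall : BFace → WallType
  fw : ℝ → ℝ

variable {gl : GaussLobatto N} {Elem IFace BFace : Type*}

namespace HexMesh

variable (mesh : HexMesh gl Elem IFace BFace)

/-- Nodal data of an element at a node of one of its sides. -/
def trace (u : Elem → Node N → NodalData) (z : Elem × Side) (a : FaceNode N) : NodalData :=
  u z.1 (faceNode z.2 a)

/-- Outward unit normal of an element at a node of one of its sides. -/
def normal (z : Elem × Side) (a : FaceNode N) : Fin 3 → ℝ :=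
  outwardNormal gl (mesh.coord z.1) z.2 a

/-- The discrete surface integral over one side of an element, in physical space. -/
def sideIntegral (z : Elem × Side) (g : FaceNode N → ℝ) : ℝ :=
  faceQuad gl (fun a => faceJacobian gl (mesh.coord z.1) z.2 a * g a)

/-- The discrete integral over the boundary of an element, in physical space. -/
def boundaryIntegral (e : Elem) (g : Side → FaceNode N → ℝ) : ℝ :=
  ∑ s : Side, mesh.sideIntegral (e, s) (g s)

/-- Left value at a node of an interior face. -/
def left (u : Elem → Node N → NodalData) (f : IFace) (a : FaceNode N) : NodalData :=
  trace u (mesh.side (.inl (.inl f))) a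

/-- Right value at a node of an interior face (the node being indexed from the left). -/
def right (u : Elem → Node N → NodalData) (f : IFace) (a : FaceNode N) : NodalData :=
  trace u (mesh.side (.inl (.inr f))) ((mesh.orient f).nodeEquiv N a)

/-- Outward normal of the left element at an interior face. -/
def normalL (f : IFace) (a : FaceNode N) : Fin 3 → ℝ := mesh.normal (mesh.side (.inl (.inl f))) a

/-- The numerical values used by an element at the nodes of one of its sides. -/
def numericalTrace (S : Scheme N IFace BFace) (u : Elem → Node N → NodalData) (z : Elem × Side)
    (a : FaceNode N) : NumericalTrace :=
  match mesh.side.symm z with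
  | .inl (.inl f) =>
      leftTrace S.prm S.interiorFlux (S.β f a) (mesh.left u f a) (mesh.right u f a)
        (mesh.normalL f a)
  | .inl (.inr f) =>
      let b := ((mesh.orient f).nodeEquiv N).symm a
      rightTrace S.prm S.interiorFlux (S.β f b) (mesh.left u f b) (mesh.right u f b)
        (mesh.normalL f b)
  | .inr g => wallTrace S.prm S.wallFlux (S.wall g) S.fw (trace u z a) (mesh.normal z a)

/-- Jacobian of an element at a node. -/
def J (e : Elem) (ν : Node N) : ℝ := jacobian gl (mesh.coord e) ν

/-- Contravariant component `J aⁱ · v` of a space vector. -/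
def contra (e : Elem) (ν : Node N) (i : Fin 3) (v : Fin 3 → ℝ) : ℝ :=
  ∑ n, metric gl (mesh.coord e) ν i n * v n

/-- Weak form of the evolution equation on element `e` (no source term); `Qt` is the time derivative
of the state vector and `φ` the test function. -/
def StateEq (S : Scheme N IFace BFace) (u : Elem → Node N → NodalData)
    (Qt : Elem → Node N → Fin 5 → ℝ) (e : Elem) (φ : Node N → Fin 5 → ℝ) : Prop :=
  volQuad gl (fun ν => mesh.J e ν * ∑ k, (u e ν).mass S.prm k * Qt e ν k * φ ν k)
    + mesh.boundaryIntegral e (fun s a =>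
        let x := trace u (e, s) a
        let n := mesh.normal (e, s) a
        let F := mesh.numericalTrace S u (e, s) a
        ∑ k, φ (faceNode s a) k *
          (F.FeN k - dotNormal n (x.Fe S.prm) k
            + (F.diamondN k - ∑ m, dotNormal n (x.Phi S.prm m) k * x.W S.prm m)))
    + volQuad gl (fun ν => ∑ k, φ ν k *
        ∑ i, refDeriv gl i
          (fun κ => mesh.contra e κ i (fun d => (u e κ).Fe S.prm d k)) ν)
    + ∑ m, volQuad gl (fun ν => ∑ k, φ ν k *
        ∑ i, mesh.contra e ν i (fun d => (u e ν).Phi S.prm m d k)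
          * refDeriv gl i (fun κ => (u e κ).W S.prm m) ν)
  = mesh.boundaryIntegral e (fun s a =>
        ∑ k, φ (faceNode s a) k * (mesh.numericalTrace S u (e, s) a).FvN k)
    - volQuad gl (fun ν => ∑ i, ∑ k,
        mesh.contra e ν i (fun d => (u e ν).Fv S.prm d k) * refDeriv gl i (fun κ => φ κ k) ν)

/-- Weak form of the definition of the gradients of the entropy variables. -/
def GradientEq (S : Scheme N IFace BFace) (u : Elem → Node N → NodalData) (e : Elem)
    (φ : Node N → Fin 3 → Fin 5 → ℝ) : Prop :=
  volQuad gl (fun ν => mesh.J e ν * ∑ d, ∑ k, (u e ν).G d k * φ ν d k)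
  = mesh.boundaryIntegral e (fun s a =>
        ∑ k, ((mesh.numericalTrace S u (e, s) a).W k - (trace u (e, s) a).W S.prm k)
          * dotNormal (mesh.normal (e, s) a) (φ (faceNode s a)) k)
    + volQuad gl (fun ν => ∑ i, ∑ k,
        mesh.contra e ν i (fun d => φ ν d k) * refDeriv gl i (fun κ => (u e κ).W S.prm k) ν)

/-- Weak form of the definition of the chemical potential. -/
def ChemicalPotentialEq (S : Scheme N IFace BFace) (u : Elem → Node N → NodalData) (e : Elem)
    (φ : Node N → ℝ) : Prop :=
  volQuad gl (fun ν => mesh.J e ν * (u e ν).μ * φ ν)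
  = volQuad gl (fun ν => mesh.J e ν * deriv (freeEnergy S.prm) (u e ν).C * φ ν)
    - mesh.boundaryIntegral e (fun s a => 3 / 2 * S.prm.σ * S.prm.ε * φ (faceNode s a)
        * (mesh.numericalTrace S u (e, s) a).GcN)
    + volQuad gl (fun ν => ∑ i,
        3 / 2 * S.prm.σ * S.prm.ε * mesh.contra e ν i (u e ν).Gc * refDeriv gl i φ ν)

/-- Weak form of the definition of the concentration gradient. -/
def ConcentrationGradientEq (S : Scheme N IFace BFace) (u : Elem → Node N → NodalData) (e : Elem)
    (φ : Node N → Fin 3 → ℝ) : Prop :=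
  volQuad gl (fun ν => mesh.J e ν * ∑ d, (u e ν).Gc d * φ ν d)
  = mesh.boundaryIntegral e (fun s a =>
        ((mesh.numericalTrace S u (e, s) a).C - (trace u (e, s) a).C)
          * ∑ d, φ (faceNode s a) d * mesh.normal (e, s) a d)
    + volQuad gl (fun ν => ∑ i,
        mesh.contra e ν i (φ ν) * refDeriv gl i (fun κ => (u e κ).C) ν)

/-- `u` is a solution of the semi-discrete scheme, without source terms and continuous in time, on
the time interval `[0,T]`, and `Qt` is the time derivative of its state vector: the four weak forms
hold on every element for all polynomial test functions at all times. -/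
structure IsSolution (S : Scheme N IFace BFace) (T : ℝ) (u : ℝ → Elem → Node N → NodalData)
    (Qt : ℝ → Elem → Node N → Fin 5 → ℝ) : Prop where
  hasDeriv : ∀ t ∈ Icc 0 T, ∀ e ν,
    HasDerivWithinAt (fun τ => (u τ e ν).Q) (Qt t e ν) (Icc 0 T) t
  stateEq : ∀ t ∈ Icc 0 T, ∀ e φ, mesh.StateEq S (u t) (Qt t) e φ
  gradientEq : ∀ t ∈ Icc 0 T, ∀ e φ, mesh.GradientEq S (u t) e φ
  chemicalPotentialEq : ∀ t ∈ Icc 0 T, ∀ e φ, mesh.ChemicalPotentialEq S (u t) e φ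
  concentrationGradientEq : ∀ t ∈ Icc 0 T, ∀ e φ, mesh.ConcentrationGradientEq S (u t) e φ

/-! ## Discrete entropy, surface free energy and dissipation -/

/-- The extended discrete entropy: entropy of all elements plus the penalty energy of the
concentration jumps at the interior faces. -/
def extendedEntropy [Fintype Elem] [Fintype IFace] (S : Scheme N IFace BFace)
    (u : Elem → Node N → NodalData) : ℝ :=
  ∑ e, volQuad gl (fun ν => mesh.J e ν * (u e ν).entropy S.prm)
    + 3 / 4 * S.prm.σ * S.prm.ε * ∑ f, mesh.sideIntegral (mesh.side (.inl (.inl f)))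
        (fun a => S.β f a * ((mesh.right u f a).C - (mesh.left u f a).C) ^ 2)

/-- The discrete surface free energy of the physical boundary. -/
def surfaceEnergy [Fintype BFace] (S : Scheme N IFace BFace) (u : Elem → Node N → NodalData) : ℝ :=
  ∑ g, mesh.sideIntegral (mesh.side (.inr g)) (fun a => S.fw (trace u (mesh.side (.inr g)) a).C)

/-- The total discrete dissipation. -/
def totalDissipation [Fintype Elem] (S : Scheme N IFace BFace) (u : Elem → Node N → NodalData) :
    ℝ :=
  ∑ e, volQuad gl (fun ν => mesh.J e ν * (u e ν).dissipation S.prm)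

end HexMesh

end

end INSCH

/-! The proof is a discrete entropy argument: test each weak form with the variable conjugate to it,
add over the elements, and look at what is left on the faces.

Inside an element the state equation is tested with the entropy variables and the gradient equation
with the viscous fluxes. The identity `NodalData.sum_W_mul_Phi` says that the non-conservative
coefficients contracted with `W` reproduce the inviscid flux. The two inviscid volume terms
therefore form a discrete product rule, and summation by parts (`GaussLobatto.sum_by_parts`,
`volQuad_by_parts`) reduces them to the boundary (`inviscid_volume`). The viscous volume terms
combine to minus the dissipation (`kinetic_balance`). The chemical potential equation is tested with
the time derivative of `C`, and the time derivative of the concentration gradient equation with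
`Gc`; their common volume term cancels. What remains is `element_balance`: the time derivative of
the entropy is minus the dissipation plus a boundary production.

The boundary productions are sorted by faces (`sum_boundaryIntegral`). This needs both sides of a
face to have the same quadrature weights and surface Jacobians and opposite normals. That holds
because the curl form uses only tangential derivatives of the face nodes, and because the
Gauss-Lobatto rule is symmetric, as follows from its uniqueness (`node_unique`).

At an interior node the Bassi-Rebay terms cancel except for `-β (R.μ - L.μ) ^ 2`, while the `β` term
in `C` is cancelled by the derivative of the penalty energy. The central inviscid fluxes contribute
nothing, by symmetry. The exact Riemann fluxes dissipate (`riemann_interior`): the jump in kinetic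
energy carried by the star-region mass flux is dominated by the quadratic terms coming from the star
pressure. At a wall the mirrored state gives zero or a nonnegative loss, and the contact condition
cancels the derivative of the surface energy. Nonnegativity of the entropy is pointwise, and
monotonicity follows from the sign of the derivative. -/

namespace INSCH

/-! ### The one-dimensional Gauss-Lobatto rule: positivity, uniqueness, symmetry, summation by
parts. -/

namespace GaussLobatto

variable {N : ℕ} (gl : GaussLobatto N)
include gl

theorem pos : 0 < N := by
  rcases Nat.eq_zero_or_pos N with rfl | h
  · have h1 := gl.node_first
    have h2 := gl.node_last
    have h3 : (Fin.last 0) = 0 := rfl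
    rw [h3, h1] at h2
    norm_num at h2
  · exact h

theorem first_ne_last : (0 : Fin (N + 1)) ≠ Fin.last N := by
  have := gl.pos
  intro h
  have h' := congrArg Fin.val h
  simp at h'
  omega

theorem injOn_node : Set.InjOn gl.node ((Finset.univ : Finset (Fin (N + 1))) : Set (Fin (N + 1))) :=
  gl.strictMono_node.injective.injOn

theorem node_mem_Icc (i : Fin (N + 1)) : gl.node i ∈ Icc (-1 : ℝ) 1 := by
  constructor
  · rw [← gl.node_first]; exact gl.strictMono_node.monotone (Fin.zero_le i)
  · rw [← gl.node_last]; exact gl.strictMono_node.monotone (Fin.le_last i)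

/-- Exactness for such a `p` leaves a single term in the sum, so the weight times a positive number
equals the integral of a nonnegative, nonzero polynomial. -/
theorem weight_pos_of_polynomial (i : Fin (N + 1)) (p : Polynomial ℝ) (hp : p.natDegree < 2 * N)
    (hnn : ∀ x ∈ Icc (-1 : ℝ) 1, 0 ≤ p.eval x) (h0 : ∀ j, j ≠ i → p.eval (gl.node j) = 0)
    (hi : p.eval (gl.node i) ≠ 0) : 0 < gl.weight i := by
  have hpos : 0 < p.eval (gl.node i) := lt_of_le_of_ne (hnn _ (gl.node_mem_Icc i)) hi.symm
  have h1 := gl.exact_of_degree p hp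
  rw [Finset.sum_eq_single i (fun j _ hj => by rw [h0 j hj, mul_zero]) (by simp)] at h1
  have h2 : 0 < ∫ x in (-1 : ℝ)..1, p.eval x :=
    intervalIntegral.integral_pos (by norm_num) p.continuous.continuousOn
      (fun x hx => hnn x (Ioc_subset_Icc_self hx)) ⟨_, gl.node_mem_Icc i, hpos⟩
  rw [← h1] at h2
  exact pos_of_mul_pos_left h2 hpos.le

theorem weight_pos (i : Fin (N + 1)) : 0 < gl.weight i := by
  classical
  have hN := gl.pos
  have hfl := gl.first_ne_last
  -- The test polynomial is the squared nodal polynomial of `s` times a low-degree factor `g` that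
  -- is nonnegative on the interval and vanishes at the end points left out of `s`. Squaring the
  -- end-point factors as well would exceed the degree of exactness.
  have key : ∀ (s : Finset (Fin (N + 1))) (g : Polynomial ℝ), i ∉ s →
      2 * s.card + g.natDegree < 2 * N → (∀ x ∈ Icc (-1 : ℝ) 1, 0 ≤ g.eval x) →
      (∀ j, j ≠ i → j ∈ s ∨ g.eval (gl.node j) = 0) → g.eval (gl.node i) ≠ 0 →
      0 < gl.weight i := by
    intro s g his hdeg hg h0 hgi
    refine gl.weight_pos_of_polynomial i (Lagrange.nodal s gl.node ^ 2 * g) ?_ ?_ ?_ ?_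
    · refine lt_of_le_of_lt Polynomial.natDegree_mul_le ?_
      refine lt_of_le_of_lt (Nat.add_le_add_right Polynomial.natDegree_pow_le _) ?_
      rwa [Lagrange.natDegree_nodal]
    · intro x hx
      rw [Polynomial.eval_mul, Polynomial.eval_pow]
      exact mul_nonneg (sq_nonneg _) (hg x hx)
    · intro j hj
      rw [Polynomial.eval_mul, Polynomial.eval_pow]
      rcases h0 j hj with h | h
      · rw [Lagrange.eval_nodal_at_node h]; ring
      · rw [h, mul_zero]
    · rw [Polynomial.eval_mul, Polynomial.eval_pow]
      refine mul_ne_zero (pow_ne_zero _ ?_) hgi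
      apply Lagrange.eval_nodal_not_at_node
      intro j hj h
      exact his (gl.strictMono_node.injective h ▸ hj)
  have hc : ((Finset.univ.erase (0 : Fin (N + 1))).erase (Fin.last N)).card = N - 1 := by
    rw [Finset.card_erase_of_mem (by simp [hfl.symm]), Finset.card_erase_of_mem (by simp)]
    simp
  have hmem : ∀ j, j ≠ 0 → j ≠ Fin.last N →
      j ∈ (Finset.univ.erase (0 : Fin (N + 1))).erase (Fin.last N) := by
    intro j h1 h2; simp [h1, h2]
  by_cases hi0 : i = 0
  -- The `N - 1` interior nodes and one linear factor give degree `2N - 1`, the largest admissible.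
  · refine key ((Finset.univ.erase 0).erase (Fin.last N)) (1 - Polynomial.X) (by simp [hi0]) ?_ ?_ ?_ ?_
    · have : (1 - Polynomial.X : Polynomial ℝ).natDegree ≤ 1 := by compute_degree
      omega
    · intro x hx; simp; exact hx.2
    · intro j hj
      by_cases h : j = Fin.last N
      · right; simp [h, gl.node_last]
      · left; exact hmem j (hi0 ▸ hj) h
    · simp [hi0, gl.node_first]
  by_cases hil : i = Fin.last N
  · refine key ((Finset.univ.erase 0).erase (Fin.last N)) (1 + Polynomial.X) (by simp [hil]) ?_ ?_ ?_ ?_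
    · have : (1 + Polynomial.X : Polynomial ℝ).natDegree ≤ 1 := by compute_degree
      omega
    · intro x hx; simp; linarith [hx.1]
    · intro j hj
      by_cases h : j = 0
      · right; simp [h, gl.node_first]
      · left; exact hmem j h (hil ▸ hj)
    · simp [hil, gl.node_last]
  · refine key (((Finset.univ.erase 0).erase (Fin.last N)).erase i) (1 - Polynomial.X ^ 2)
      (by simp) ?_ ?_ ?_ ?_
    · have : (1 - Polynomial.X ^ 2 : Polynomial ℝ).natDegree ≤ 2 := by compute_degree
      rw [Finset.card_erase_of_mem (hmem i hi0 hil), hc]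
      -- An interior node exists, so the cardinality `N - 1 - 1` is not truncated and the degree is
      -- at most `2(N - 2) + 2`.
      have h2 : 0 < N - 1 := by
        rw [← hc]; exact Finset.card_pos.2 ⟨i, hmem i hi0 hil⟩
      omega
    · intro x hx; simp [abs_le, hx.1, hx.2]
    · intro j hj
      by_cases h : j = 0
      · right; simp [h, gl.node_first]
      by_cases h' : j = Fin.last N
      · right; simp [h', gl.node_last]
      · left; simp [h, h', hj]
    · have h1 : -1 < gl.node i := by
        rw [← gl.node_first]; exact gl.strictMono_node (Fin.pos_iff_ne_zero.2 hi0)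
      have h2 : gl.node i < 1 := by
        rw [← gl.node_last]; exact gl.strictMono_node (lt_of_le_of_ne (Fin.le_last i) hil)
      simp
      nlinarith

/-- Two Gauss-Lobatto rules have the same nodes. -/
theorem node_unique (gl' : GaussLobatto N) : gl.node = gl'.node := by
  have hN := gl.pos
  set q := Lagrange.nodal Finset.univ gl.node with hq
  set q' := Lagrange.nodal Finset.univ gl'.node with hq'
  have hqd : q.natDegree = N + 1 := by rw [hq, Lagrange.natDegree_nodal]; simp
  have hqd' : q'.natDegree = N + 1 := by rw [hq', Lagrange.natDegree_nodal]; simp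
  have hz : ∀ i, q.eval (gl.node i) = 0 := fun i => Lagrange.eval_nodal_at_node (Finset.mem_univ i)
  have hz' : ∀ i, q'.eval (gl'.node i) = 0 :=
    fun i => Lagrange.eval_nodal_at_node (Finset.mem_univ i)
  -- Both nodal polynomials are monic and vanish at `±1`, so their difference is `(X - 1)(X + 1) e`
  -- with `e` of degree at most `N - 2`. Each rule integrates its own nodal polynomial times `e`
  -- exactly, to zero; hence the integral of `(1 - x²) e²` vanishes.
  have hzero : q - q' = 0 := by
    by_contra hne
    have hroot1 : (q - q').IsRoot 1 := by
      have h1 := hz (Fin.last N)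
      have h2 := hz' (Fin.last N)
      rw [gl.node_last] at h1
      rw [gl'.node_last] at h2
      simp [Polynomial.IsRoot, h1, h2]
    have hroot2 : (q - q').IsRoot (-1) := by
      have h1 := hz 0
      have h2 := hz' 0
      rw [gl.node_first] at h1
      rw [gl'.node_first] at h2
      simp [Polynomial.IsRoot, h1, h2]
    have hd1 := Polynomial.dvd_iff_isRoot.2 hroot1
    have hd2 := Polynomial.dvd_iff_isRoot.2 hroot2
    have hcop : IsCoprime (Polynomial.X - Polynomial.C (1 : ℝ))
        (Polynomial.X - Polynomial.C (-1 : ℝ)) :=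
      Polynomial.isCoprime_X_sub_C_of_isUnit_sub (by norm_num)
    obtain ⟨e, he⟩ := hcop.mul_dvd hd1 hd2
    have he0 : e ≠ 0 := by rintro rfl; exact hne (by rw [he, mul_zero])
    have hdeg : (q - q').natDegree ≤ N := by
      have hlt : (q - q').degree < q.degree := Polynomial.degree_sub_lt_left
        (by rw [hq, hq', Lagrange.degree_nodal, Lagrange.degree_nodal])
        (Lagrange.nodal_ne_zero)
        (by rw [hq, hq', Lagrange.nodal_monic.leadingCoeff, Lagrange.nodal_monic.leadingCoeff])
      have := Polynomial.natDegree_lt_natDegree hne hlt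
      omega
    have hdeg2 : (q - q').natDegree = 2 + e.natDegree := by
      rw [he, Polynomial.natDegree_mul (mul_ne_zero (Polynomial.X_sub_C_ne_zero _)
        (Polynomial.X_sub_C_ne_zero _)) he0, Polynomial.natDegree_mul (Polynomial.X_sub_C_ne_zero _)
        (Polynomial.X_sub_C_ne_zero _), Polynomial.natDegree_X_sub_C, Polynomial.natDegree_X_sub_C]
    have h1 : ∫ x in (-1 : ℝ)..1, (q * e).eval x = 0 := by
      rw [← gl.exact_of_degree (q * e) (lt_of_le_of_lt Polynomial.natDegree_mul_le (by omega))]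
      simp [hz]
    have h2 : ∫ x in (-1 : ℝ)..1, (q' * e).eval x = 0 := by
      rw [← gl'.exact_of_degree (q' * e) (lt_of_le_of_lt Polynomial.natDegree_mul_le (by omega))]
      simp [hz']
    have h3 : ∫ x in (-1 : ℝ)..1, (q' * e - q * e).eval x = 0 := by
      have : ∀ x, (q' * e - q * e).eval x = (q' * e).eval x - (q * e).eval x := fun x => by simp
      simp_rw [this]
      rw [intervalIntegral.integral_sub ((q' * e).continuous.intervalIntegrable _ _)
        ((q * e).continuous.intervalIntegrable _ _), h1, h2, sub_zero]
    have h4 : ∀ x, (q' * e - q * e).eval x = (1 - x ^ 2) * (e.eval x) ^ 2 := by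
      intro x
      have : q' * e - q * e = -((q - q') * e) := by ring
      rw [this, he]
      simp
      ring
    obtain ⟨c, hc, hec⟩ : ∃ c ∈ Ioo (-1 : ℝ) 1, e.eval c ≠ 0 := by
      by_contra hcon
      push Not at hcon
      apply he0
      apply Polynomial.eq_zero_of_infinite_isRoot
      exact (Ioo_infinite (by norm_num : (-1 : ℝ) < 1)).mono hcon
    have h5 : 0 < ∫ x in (-1 : ℝ)..1, (q' * e - q * e).eval x := by
      refine intervalIntegral.integral_pos (by norm_num) (Polynomial.continuous _).continuousOn ?_
        ⟨c, Ioo_subset_Icc_self hc, ?_⟩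
      · intro x hx
        rw [h4]
        exact mul_nonneg (by nlinarith [hx.1, hx.2]) (sq_nonneg _)
      · rw [h4]
        have : 0 < 1 - c ^ 2 := by nlinarith [hc.1, hc.2]
        positivity
    exact h5.ne' h3
  have hqq : q = q' := sub_eq_zero.1 hzero
  have hmem : ∀ (g : GaussLobatto N) (x : ℝ),
      x ∈ range g.node ↔ (Lagrange.nodal Finset.univ g.node).eval x = 0 := by
    intro g x
    rw [Lagrange.eval_nodal, Finset.prod_eq_zero_iff]
    constructor
    · rintro ⟨i, rfl⟩; exact ⟨i, Finset.mem_univ i, sub_self _⟩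
    · rintro ⟨i, -, h⟩; exact ⟨i, (sub_eq_zero.1 h).symm⟩
  refine (gl.strictMono_node.range_inj gl'.strictMono_node).1 ?_
  ext x
  rw [hmem, hmem, ← hq, ← hq', hqq]

/-- The weights are functions of the nodes alone, so uniqueness of the nodes carries over to them.
Exactness covers degree `N` because `N < 2N`. -/
theorem weight_eq_integral (i : Fin (N + 1)) :
    gl.weight i = ∫ x in (-1 : ℝ)..1, (Lagrange.basis Finset.univ gl.node i).eval x := by
  have hN := gl.pos
  rw [← gl.exact_of_degree, Finset.sum_eq_single i]
  · rw [Lagrange.eval_basis_self gl.injOn_node (Finset.mem_univ i), mul_one]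
  · intro j _ hj
    rw [Lagrange.eval_basis_of_ne hj.symm (Finset.mem_univ j), mul_zero]
  · simp
  · rw [Lagrange.natDegree_basis gl.injOn_node (Finset.mem_univ i)]
    simp
    omega

/-- The rule reflected about the origin. -/
@[simps]
def reflect : GaussLobatto N where
  node i := -gl.node i.rev
  weight i := gl.weight i.rev
  strictMono_node i j h := neg_lt_neg (gl.strictMono_node (Fin.rev_lt_rev.2 h))
  node_first := by rw [Fin.rev_zero, gl.node_last]
  node_last := by rw [Fin.rev_last, gl.node_first, neg_neg]
  exact_of_degree p hp := by
    have h := gl.exact_of_degree (p.comp (-Polynomial.X))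
      (lt_of_le_of_lt Polynomial.natDegree_comp_le (by simpa using hp))
    simp only [Polynomial.eval_comp, Polynomial.eval_neg, Polynomial.eval_X] at h
    rw [intervalIntegral.integral_comp_neg (fun x => p.eval x), neg_neg] at h
    rw [← h]
    exact Equiv.sum_comp Fin.revPerm (fun i => gl.weight i * p.eval (-gl.node i))

/-- The reflected rule is again a Gauss-Lobatto rule, so it has the same nodes. -/
theorem node_rev (i : Fin (N + 1)) : gl.node i.rev = -gl.node i := by
  have h := congrFun (gl.node_unique gl.reflect) i
  rw [reflect_node] at h
  linarith

theorem weight_rev (i : Fin (N + 1)) : gl.weight i.rev = gl.weight i := by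
  have h := gl.weight_eq_integral i
  rw [gl.node_unique gl.reflect, ← weight_eq_integral, reflect_weight] at h
  exact h.symm

/-- Two polynomials of degree at most `N` that agree at the `N + 1` nodes coincide; the symmetry of
the nodes supplies the agreement. -/
theorem basis_rev (j : Fin (N + 1)) : Lagrange.basis Finset.univ gl.node j.rev
    = (Lagrange.basis Finset.univ gl.node j).comp (-Polynomial.X) := by
  have hdeg : ∀ k, (Lagrange.basis Finset.univ gl.node k).natDegree = N := fun k => by
    rw [Lagrange.natDegree_basis gl.injOn_node (Finset.mem_univ k)]; simp
  have hlt : ∀ p : Polynomial ℝ, p.natDegree ≤ N →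
      p.degree < ((Finset.univ : Finset (Fin (N + 1))).card : ℕ) := fun p hp =>
    lt_of_le_of_lt (Polynomial.degree_le_of_natDegree_le hp) (by simp; exact_mod_cast Nat.lt_succ_self N)
  refine Polynomial.eq_of_degrees_lt_of_eval_index_eq _ gl.injOn_node
    (hlt _ (hdeg _).le) (hlt _ ?_) ?_
  · refine Polynomial.natDegree_comp_le.trans ?_
    rw [hdeg]; simp
  · intro i _
    simp only [Polynomial.eval_comp, Polynomial.eval_neg, Polynomial.eval_X]
    rw [← gl.node_rev]
    by_cases h : i = j.rev
    · rw [h, Fin.rev_rev, Lagrange.eval_basis_self gl.injOn_node (Finset.mem_univ _),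
        Lagrange.eval_basis_self gl.injOn_node (Finset.mem_univ _)]
    · rw [Lagrange.eval_basis_of_ne (Ne.symm h) (Finset.mem_univ _),
        Lagrange.eval_basis_of_ne _ (Finset.mem_univ _)]
      rintro rfl
      exact h (Fin.rev_rev i).symm

theorem derivMatrix_rev (i j : Fin (N + 1)) :
    derivMatrix gl i.rev j.rev = -derivMatrix gl i j := by
  unfold derivMatrix
  rw [gl.basis_rev, Polynomial.derivative_comp, gl.node_rev]
  simp

/-- Summation by parts for the one-dimensional rule. -/
theorem sum_by_parts (f g : Fin (N + 1) → ℝ) :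
    ∑ i, gl.weight i * (f i * ∑ j, derivMatrix gl i j * g j)
      + ∑ i, gl.weight i * ((∑ j, derivMatrix gl i j * f j) * g i)
    = f (Fin.last N) * g (Fin.last N) - f 0 * g 0 := by
  have hN := gl.pos
  set I := fun h : Fin (N + 1) → ℝ => Lagrange.interpolate Finset.univ gl.node h with hI
  have hev : ∀ h i, (I h).eval (gl.node i) = h i := fun h i =>
    Lagrange.eval_interpolate_at_node _ gl.injOn_node (Finset.mem_univ i)
  have hder : ∀ h i, (Polynomial.derivative (I h)).eval (gl.node i)
      = ∑ j, derivMatrix gl i j * h j := by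
    intro h i
    simp only [hI, Lagrange.interpolate_apply, Polynomial.derivative_sum, Polynomial.eval_finsetSum]
    refine Finset.sum_congr rfl fun j _ => ?_
    rw [Polynomial.derivative_C_mul, Polynomial.eval_mul, Polynomial.eval_C, derivMatrix, mul_comm]
  have hdeg : ∀ h, (I h).natDegree ≤ N := by
    intro h
    have := Lagrange.degree_interpolate_le h gl.injOn_node
    rw [Finset.card_univ, Fintype.card_fin] at this
    exact Polynomial.natDegree_le_of_degree_le this
  -- The product of two interpolants has degree at most `2N`, so its derivative just meets the
  -- degree of exactness and the quadrature equals the difference of the end-point values.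
  have hex := gl.exact_of_degree (Polynomial.derivative (I f * I g)) (by
    refine lt_of_le_of_lt (Polynomial.natDegree_derivative_le _) ?_
    have := Polynomial.natDegree_mul_le (p := I f) (q := I g)
    have h1 := hdeg f
    have h2 := hdeg g
    omega)
  rw [intervalIntegral.integral_eq_sub_of_hasDerivAt (fun x _ => (I f * I g).hasDerivAt x)
    ((Polynomial.continuous _).intervalIntegrable _ _)] at hex
  rw [← gl.node_first, ← gl.node_last] at hex
  simp only [Polynomial.derivative_mul, Polynomial.eval_add, Polynomial.eval_mul, hev, hder] at hex
  rw [← hex, ← Finset.sum_add_distrib]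
  refine Finset.sum_congr rfl fun i _ => by ring

end GaussLobatto

/-! ### Tensor-product structure of the cube and summation by parts in three dimensions. -/

variable {N : ℕ}

/-- The node on the line in direction `i` through the face node `a`, at position `m`. -/
def lineNode (i : Fin 3) (a : FaceNode N) (m : Fin (N + 1)) : Node N := fun d =>
  if d = i then m else if d = i + 1 then a.1 else a.2

theorem faceNode_eq_lineNode (s : Side) (a : FaceNode N) :
    faceNode s a = lineNode s.1 a (if s.2 then Fin.last N else 0) := rfl

@[simp] theorem lineNode_self (i : Fin 3) (a : FaceNode N) (m : Fin (N + 1)) :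
    lineNode i a m i = m := by simp [lineNode]

@[simp] theorem lineNode_add_one (i : Fin 3) (a : FaceNode N) (m : Fin (N + 1)) :
    lineNode i a m (i + 1) = a.1 := by fin_cases i <;> simp [lineNode]

@[simp] theorem lineNode_add_two (i : Fin 3) (a : FaceNode N) (m : Fin (N + 1)) :
    lineNode i a m (i + 2) = a.2 := by
  fin_cases i <;> simp [lineNode]

theorem update_lineNode_self (i : Fin 3) (a : FaceNode N) (m k : Fin (N + 1)) :
    Function.update (lineNode i a m) i k = lineNode i a k := by
  ext d
  by_cases h : d = i <;> simp [lineNode, h]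

theorem update_lineNode_add_one (i : Fin 3) (a : FaceNode N) (m k : Fin (N + 1)) :
    Function.update (lineNode i a m) (i + 1) k = lineNode i (k, a.2) m := by
  ext d
  by_cases h : d = i + 1
  · subst h; simp
  · simp [lineNode, h]

theorem update_lineNode_add_two (i : Fin 3) (a : FaceNode N) (m k : Fin (N + 1)) :
    Function.update (lineNode i a m) (i + 2) k = lineNode i (a.1, k) m := by
  ext d
  by_cases h : d = i + 2
  · subst h; simp
  · have : d = i ∨ d = i + 1 := by revert h; revert i d; decide
    rcases this with rfl | rfl <;> simp [h]

/-- The nodes of the cube, sorted by the lines in direction `i`. -/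
def lineEquiv (N : ℕ) (i : Fin 3) : FaceNode N × Fin (N + 1) ≃ Node N where
  toFun p := lineNode i p.1 p.2
  invFun ν := ((ν (i + 1), ν (i + 2)), ν i)
  left_inv p := by simp
  right_inv ν := by
    ext d
    have : d = i ∨ d = i + 1 ∨ d = i + 2 := by revert i d; decide
    rcases this with rfl | rfl | rfl <;> simp

variable (gl : GaussLobatto N)

theorem refDeriv_lineNode_self (i : Fin 3) (f : Node N → ℝ) (a : FaceNode N) (m : Fin (N + 1)) :
    refDeriv gl i f (lineNode i a m) = ∑ k, derivMatrix gl m k * f (lineNode i a k) := by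
  simp only [refDeriv, lineNode_self, update_lineNode_self]

theorem refDeriv_lineNode_add_one (i : Fin 3) (f : Node N → ℝ) (a : FaceNode N)
    (m : Fin (N + 1)) : refDeriv gl (i + 1) f (lineNode i a m)
      = ∑ k, derivMatrix gl a.1 k * f (lineNode i (k, a.2) m) := by
  simp only [refDeriv, lineNode_add_one, update_lineNode_add_one]

theorem refDeriv_lineNode_add_two (i : Fin 3) (f : Node N → ℝ) (a : FaceNode N)
    (m : Fin (N + 1)) : refDeriv gl (i + 2) f (lineNode i a m)
      = ∑ k, derivMatrix gl a.2 k * f (lineNode i (a.1, k) m) := by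
  simp only [refDeriv, lineNode_add_two, update_lineNode_add_two]

/-- The weights are products, so the volume sum can be grouped by lines in any direction `i`; this
lets the one-dimensional summation by parts act line by line. -/
theorem volQuad_eq_faceQuad (i : Fin 3) (f : Node N → ℝ) :
    volQuad gl f = faceQuad gl (fun a => ∑ m, gl.weight m * f (lineNode i a m)) := by
  have hw : ∀ ν : Node N, gl.weight (ν 0) * gl.weight (ν 1) * gl.weight (ν 2)
      = gl.weight (ν (i + 1)) * gl.weight (ν (i + 2)) * gl.weight (ν i) := by
    intro ν
    fin_cases i
    · simp; ring
    · have h : (1 : Fin 3) + 1 = 2 := rfl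
      have h' : (1 : Fin 3) + 2 = 0 := rfl
      simp [h, h']; ring
    · have h : (2 : Fin 3) + 1 = 0 := rfl
      have h' : (2 : Fin 3) + 2 = 1 := rfl
      simp [h, h']
  unfold volQuad faceQuad
  simp_rw [hw]
  rw [← Equiv.sum_comp (lineEquiv N i), Fintype.sum_prod_type]
  refine Finset.sum_congr rfl fun a _ => ?_
  rw [Finset.mul_sum]
  refine Finset.sum_congr rfl fun m _ => ?_
  simp only [lineEquiv, Equiv.coe_fn_mk, lineNode_self, lineNode_add_one, lineNode_add_two]
  ring

theorem faceQuad_add (f g : FaceNode N → ℝ) :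
    faceQuad gl (fun a => f a + g a) = faceQuad gl f + faceQuad gl g := by
  simp only [faceQuad, mul_add, Finset.sum_add_distrib]

theorem faceQuad_sub (f g : FaceNode N → ℝ) :
    faceQuad gl (fun a => f a - g a) = faceQuad gl f - faceQuad gl g := by
  simp only [faceQuad, mul_sub, Finset.sum_sub_distrib]

theorem faceQuad_const_mul (c : ℝ) (f : FaceNode N → ℝ) :
    faceQuad gl (fun a => c * f a) = c * faceQuad gl f := by
  rw [faceQuad, faceQuad, Finset.mul_sum]
  exact Finset.sum_congr rfl fun a _ => by ring

theorem volQuad_add (f g : Node N → ℝ) :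
    volQuad gl (fun ν => f ν + g ν) = volQuad gl f + volQuad gl g := by
  simp only [volQuad, mul_add, Finset.sum_add_distrib]

theorem volQuad_sub (f g : Node N → ℝ) :
    volQuad gl (fun ν => f ν - g ν) = volQuad gl f - volQuad gl g := by
  simp only [volQuad, mul_sub, Finset.sum_sub_distrib]

theorem volQuad_const_mul (c : ℝ) (f : Node N → ℝ) :
    volQuad gl (fun a => c * f a) = c * volQuad gl f := by
  rw [volQuad, volQuad, Finset.mul_sum]
  exact Finset.sum_congr rfl fun a _ => by ring

theorem volQuad_sum {ι : Type*} (s : Finset ι) (f : ι → Node N → ℝ) :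
    volQuad gl (fun ν => ∑ i ∈ s, f i ν) = ∑ i ∈ s, volQuad gl (f i) := by
  simp only [volQuad, Finset.mul_sum]
  exact Finset.sum_comm

theorem volQuad_nonneg {f : Node N → ℝ} (h : ∀ ν, 0 ≤ f ν) : 0 ≤ volQuad gl f :=
  Finset.sum_nonneg fun ν _ => mul_nonneg (mul_nonneg (mul_nonneg (gl.weight_pos _).le
    (gl.weight_pos _).le) (gl.weight_pos _).le) (h ν)

theorem faceQuad_nonneg {f : FaceNode N → ℝ} (h : ∀ a, 0 ≤ f a) : 0 ≤ faceQuad gl f :=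
  Finset.sum_nonneg fun a _ => mul_nonneg (mul_nonneg (gl.weight_pos _).le
    (gl.weight_pos _).le) (h a)

/-- Summation by parts on the reference cube. -/
theorem volQuad_by_parts (i : Fin 3) (f g : Node N → ℝ) :
    volQuad gl (fun ν => f ν * refDeriv gl i g ν) + volQuad gl (fun ν => refDeriv gl i f ν * g ν)
    = ∑ b : Bool, faceQuad gl (fun a =>
        sideSign (i, b) * (f (faceNode (i, b) a) * g (faceNode (i, b) a))) := by
  rw [volQuad_eq_faceQuad gl i, volQuad_eq_faceQuad gl i, ← faceQuad_add, Fintype.sum_bool,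
    ← faceQuad_add]
  congr 1
  ext a
  simp only [refDeriv_lineNode_self, faceNode_eq_lineNode, sideSign]
  rw [gl.sum_by_parts (fun m => f (lineNode i a m)) (fun m => g (lineNode i a m))]
  simp
  ring

end INSCH

namespace INSCH

/-! ### Metric terms on faces and the gluing of neighbouring elements. -/

section Geometry

variable {N : ℕ} (gl : GaussLobatto N)

/-- The normal metric terms on a face in terms of the coordinates `x` of the face nodes. -/
noncomputable def faceMetric (x : FaceNode N → Fin 3 → ℝ) (a : FaceNode N) (n : Fin 3) : ℝ :=
  -((∑ k, derivMatrix gl a.1 k *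
        (x (k, a.2) (n + 2) * ∑ l, derivMatrix gl a.2 l * x (k, l) (n + 1)))
    - ∑ l, derivMatrix gl a.2 l *
        (x (a.1, l) (n + 2) * ∑ k, derivMatrix gl a.1 k * x (k, l) (n + 1)))

/-- The component of a curl normal to a side involves only the two tangential derivatives, so
neighbours that share their face nodes share these metric terms up to orientation. -/
theorem metric_faceNode (X : Node N → Fin 3 → ℝ) (s : Side) (a : FaceNode N) (n : Fin 3) :
    metric gl X (faceNode s a) s.1 n = faceMetric gl (fun b => X (faceNode s b)) a n := by
  simp only [metric, faceNode_eq_lineNode, refDeriv_lineNode_add_one, refDeriv_lineNode_add_two,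
    faceMetric]

theorem sum_derivMatrix_rev (i : Fin (N + 1)) (g : Fin (N + 1) → ℝ) :
    ∑ k, derivMatrix gl i.rev k * g k = -∑ k, derivMatrix gl i k * g k.rev := by
  rw [← Equiv.sum_comp Fin.revPerm, ← Finset.sum_neg_distrib]
  simp [gl.derivMatrix_rev]

/-- Each term contains exactly one derivative in the first tangential direction, and that derivative
is odd under reflection by `derivMatrix_rev`. -/
theorem faceMetric_flip_fst (x : FaceNode N → Fin 3 → ℝ) (a : FaceNode N) (n : Fin 3) :
    faceMetric gl (fun b => x (b.1.rev, b.2)) a n = -faceMetric gl x (a.1.rev, a.2) n := by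
  simp only [faceMetric]
  rw [sum_derivMatrix_rev]
  simp only [sum_derivMatrix_rev gl a.1 (fun k => x (k, _) (n + 1)), mul_neg,
    Finset.sum_neg_distrib]
  ring

/-- Interchanging the tangential directions interchanges the two terms of the curl. -/
theorem faceMetric_swap (x : FaceNode N → Fin 3 → ℝ) (a : FaceNode N) (n : Fin 3) :
    faceMetric gl (fun b => x b.swap) a n = -faceMetric gl x a.swap n := by
  simp only [faceMetric, Prod.swap_prod_mk, Prod.fst_swap, Prod.snd_swap]
  ring

/-- Reversing the second coordinate is reversing the first, conjugated by the swap; the three signs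
multiply to `-1`. -/
theorem faceMetric_flip_snd (x : FaceNode N → Fin 3 → ℝ) (a : FaceNode N) (n : Fin 3) :
    faceMetric gl (fun b => x (b.1, b.2.rev)) a n = -faceMetric gl x (a.1, a.2.rev) n := by
  have h1 := faceMetric_swap gl (fun b => x (b.2, b.1.rev)) a n
  have h2 := faceMetric_flip_fst gl (fun b => x b.swap) a.swap n
  have h3 := faceMetric_swap gl x (a.2.rev, a.1) n
  simp only [Prod.swap_prod_mk, Prod.fst_swap, Prod.snd_swap] at h1 h2 h3
  rw [h1, h2, h3]
  ring

theorem faceMetric_nodeEquiv (o : FaceOrientation) (x : FaceNode N → Fin 3 → ℝ) (a : FaceNode N)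
    (n : Fin 3) : faceMetric gl (fun b => x (o.nodeEquiv N b)) a n
      = o.det * faceMetric gl x (o.nodeEquiv N a) n := by
  have h1 : ∀ (y : FaceNode N → Fin 3 → ℝ) a,
      faceMetric gl (fun b => y ((if o.flip₁ then Fin.revPerm else Equiv.refl _) b.1, b.2)) a n
      = (if o.flip₁ then -1 else 1)
        * faceMetric gl y ((if o.flip₁ then Fin.revPerm else Equiv.refl _) a.1, a.2) n := by
    intro y a
    cases o.flip₁
    · simp
    · simpa using faceMetric_flip_fst gl y a n
  have h2 : ∀ (y : FaceNode N → Fin 3 → ℝ) a,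
      faceMetric gl (fun b => y (b.1, (if o.flip₂ then Fin.revPerm else Equiv.refl _) b.2)) a n
      = (if o.flip₂ then -1 else 1)
        * faceMetric gl y (a.1, (if o.flip₂ then Fin.revPerm else Equiv.refl _) a.2) n := by
    intro y a
    cases o.flip₂
    · simp
    · simpa using faceMetric_flip_snd gl y a n
  have h3 : ∀ (y : FaceNode N → Fin 3 → ℝ) a,
      faceMetric gl (fun b => y ((if o.swap then Equiv.prodComm _ _ else Equiv.refl _) b)) a n
      = (if o.swap then -1 else 1)
        * faceMetric gl y ((if o.swap then Equiv.prodComm _ _ else Equiv.refl _) a) n := by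
    intro y a
    cases o.swap
    · simp
    · simpa using faceMetric_swap gl y a n
  simp only [FaceOrientation.nodeEquiv, FaceOrientation.det, Equiv.trans_apply,
    Equiv.prodCongr_apply, Prod.map_apply']
  rw [h1 (fun b => x ((if o.swap then Equiv.prodComm _ _ else Equiv.refl _)
      (b.1, (if o.flip₂ then Fin.revPerm else Equiv.refl _) b.2))),
    h2 (fun b => x ((if o.swap then Equiv.prodComm _ _ else Equiv.refl _) b)), h3]
  ring

theorem weight_nodeEquiv (o : FaceOrientation) (a : FaceNode N) :
    gl.weight (o.nodeEquiv N a).1 * gl.weight (o.nodeEquiv N a).2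
      = gl.weight a.1 * gl.weight a.2 := by
  rcases o with ⟨_ | _, _ | _, _ | _⟩ <;>
    simp [FaceOrientation.nodeEquiv, gl.weight_rev, mul_comm]

theorem sideSign_mul_self (s : Side) : sideSign s * sideSign s = 1 := by
  unfold sideSign
  split_ifs <;> norm_num

theorem faceJacobian_nonneg (X : Node N → Fin 3 → ℝ) (s : Side) (a : FaceNode N) :
    0 ≤ faceJacobian gl X s a := Real.sqrt_nonneg _

/-- No regularity is needed: a zero surface Jacobian forces the metric vector to vanish, so both
sides are zero whatever value the quotient defining the normal takes there. -/
theorem faceJacobian_mul_outwardNormal (X : Node N → Fin 3 → ℝ) (s : Side) (a : FaceNode N)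
    (n : Fin 3) : faceJacobian gl X s a * outwardNormal gl X s a n
      = sideSign s * metric gl X (faceNode s a) s.1 n := by
  unfold outwardNormal
  by_cases h : faceJacobian gl X s a = 0
  · have h' := h
    rw [faceJacobian, Real.sqrt_eq_zero (Finset.sum_nonneg fun _ _ => sq_nonneg _),
      Finset.sum_eq_zero_iff_of_nonneg fun _ _ => sq_nonneg _] at h'
    rw [h, zero_mul, pow_eq_zero_iff two_ne_zero |>.1 (h' n (Finset.mem_univ n)), mul_zero]
  · field_simp

theorem sum_outwardNormal_sq (X : Node N → Fin 3 → ℝ) (s : Side) (a : FaceNode N)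
    (h : faceJacobian gl X s a ≠ 0) : ∑ n, outwardNormal gl X s a n ^ 2 = 1 := by
  have hsq : ∑ n, metric gl X (faceNode s a) s.1 n ^ 2 = faceJacobian gl X s a ^ 2 :=
    (Real.sq_sqrt (Finset.sum_nonneg fun _ _ => sq_nonneg _)).symm
  have hs : sideSign s ^ 2 = 1 := by rw [sq, sideSign_mul_self]
  simp only [outwardNormal, div_pow, mul_pow, hs, one_mul]
  rw [← Finset.sum_div, hsq, div_self (pow_ne_zero _ h)]

variable {gl} {Elem IFace BFace : Type*} (mesh : HexMesh gl Elem IFace BFace)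

namespace HexMesh

/-- The gluing multiplies the face metric by its determinant, and `opposite` says that this sign
together with the two side signs is `-1`. -/
theorem metric_right (f : IFace) (a : FaceNode N) (n : Fin 3) :
    sideSign (mesh.side (.inl (.inr f))).2
        * metric gl (mesh.coord (mesh.side (.inl (.inr f))).1)
          (faceNode (mesh.side (.inl (.inr f))).2 ((mesh.orient f).nodeEquiv N a))
          (mesh.side (.inl (.inr f))).2.1 n
      = -(sideSign (mesh.side (.inl (.inl f))).2
        * metric gl (mesh.coord (mesh.side (.inl (.inl f))).1)
          (faceNode (mesh.side (.inl (.inl f))).2 a) (mesh.side (.inl (.inl f))).2.1 n) := by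
  have h1 := faceMetric_nodeEquiv gl (mesh.orient f) (fun b =>
    mesh.coord (mesh.side (.inl (.inr f))).1 (faceNode (mesh.side (.inl (.inr f))).2 b)) a n
  simp only [mesh.conforming] at h1
  rw [metric_faceNode, metric_faceNode, h1]
  have h2 := mesh.opposite f
  have h3 := sideSign_mul_self (mesh.side (.inl (.inr f))).2
  set m := faceMetric gl (fun b => mesh.coord (mesh.side (.inl (.inr f))).1
    (faceNode (mesh.side (.inl (.inr f))).2 b)) ((mesh.orient f).nodeEquiv N a) n
  linear_combination (m * sideSign (mesh.side (.inl (.inr f))).2) * h2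
    - m * (sideSign (mesh.side (.inl (.inl f))).2 * (mesh.orient f).det) * h3

theorem faceJacobian_right (f : IFace) (a : FaceNode N) :
    faceJacobian gl (mesh.coord (mesh.side (.inl (.inr f))).1) (mesh.side (.inl (.inr f))).2
        ((mesh.orient f).nodeEquiv N a)
      = faceJacobian gl (mesh.coord (mesh.side (.inl (.inl f))).1) (mesh.side (.inl (.inl f))).2
        a := by
  unfold faceJacobian
  congr 1
  refine Finset.sum_congr rfl fun n _ => ?_
  have h := congrArg (· ^ 2) (mesh.metric_right f a n)
  simpa only [mul_pow, neg_sq, sq (sideSign _), sideSign_mul_self, one_mul] using h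

/-- The outward normals of the two elements at an interior face are opposite. -/
theorem normal_right (f : IFace) (a : FaceNode N) :
    mesh.normal (mesh.side (.inl (.inr f))) ((mesh.orient f).nodeEquiv N a)
      = -mesh.normalL f a := by
  ext n
  simp only [normalL, normal, outwardNormal, Pi.neg_apply, mesh.faceJacobian_right,
    mesh.metric_right, neg_div]

/-- The discrete integral over the right side of an interior face in terms of the left side. -/
theorem sideIntegral_right (f : IFace) (g : FaceNode N → ℝ) :
    mesh.sideIntegral (mesh.side (.inl (.inr f))) g
      = mesh.sideIntegral (mesh.side (.inl (.inl f)))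
        (fun a => g ((mesh.orient f).nodeEquiv N a)) := by
  unfold sideIntegral faceQuad
  rw [← Equiv.sum_comp ((mesh.orient f).nodeEquiv N)]
  simp only [weight_nodeEquiv, mesh.faceJacobian_right]

/-- The sum of the element boundary integrals, sorted by faces. -/
theorem sum_boundaryIntegral [Fintype Elem] [Fintype IFace] [Fintype BFace]
    (g : Elem × Side → FaceNode N → ℝ) :
    ∑ e, mesh.boundaryIntegral e (fun s => g (e, s))
      = ∑ f, mesh.sideIntegral (mesh.side (.inl (.inl f)))
          (fun a => g (mesh.side (.inl (.inl f))) a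
            + g (mesh.side (.inl (.inr f))) ((mesh.orient f).nodeEquiv N a))
        + ∑ b, mesh.sideIntegral (mesh.side (.inr b)) (g (mesh.side (.inr b))) := by
  have h : ∀ f, mesh.sideIntegral (mesh.side (.inl (.inl f)))
          (fun a => g (mesh.side (.inl (.inl f))) a
            + g (mesh.side (.inl (.inr f))) ((mesh.orient f).nodeEquiv N a))
      = mesh.sideIntegral (mesh.side (.inl (.inl f))) (g (mesh.side (.inl (.inl f))))
        + mesh.sideIntegral (mesh.side (.inl (.inr f))) (g (mesh.side (.inl (.inr f)))) := by
    intro f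
    rw [mesh.sideIntegral_right, sideIntegral, sideIntegral, sideIntegral, ← faceQuad_add]
    simp only [mul_add]
  simp only [boundaryIntegral, h, Finset.sum_add_distrib]
  rw [← Fintype.sum_prod_type (f := fun z => mesh.sideIntegral z (g z)), ← Equiv.sum_comp mesh.side,
    Fintype.sum_sum_type, Fintype.sum_sum_type]

end HexMesh

end Geometry
end INSCH

namespace INSCH

/-! ### Pointwise algebra of the numerical fluxes. -/

section Fluxes

variable (prm : Params)

@[simp] theorem mkState_zero (a : ℝ) (v : Fin 3 → ℝ) (b : ℝ) : mkState a v b 0 = a := rfl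
@[simp] theorem mkState_one (a : ℝ) (v : Fin 3 → ℝ) (b : ℝ) : mkState a v b 1 = v 0 := rfl
@[simp] theorem mkState_two (a : ℝ) (v : Fin 3 → ℝ) (b : ℝ) : mkState a v b 2 = v 1 := rfl
@[simp] theorem mkState_three (a : ℝ) (v : Fin 3 → ℝ) (b : ℝ) : mkState a v b 3 = v 2 := rfl
@[simp] theorem mkState_four (a : ℝ) (v : Fin 3 → ℝ) (b : ℝ) : mkState a v b 4 = b := rfl

@[simp] theorem spIdx_zero : spIdx 0 = 1 := rfl
@[simp] theorem spIdx_one : spIdx 1 = 2 := rfl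
@[simp] theorem spIdx_two : spIdx 2 = 3 := rfl

theorem acModulus_pos : 0 < acModulus prm :=
  mul_pos (lt_max_of_lt_left prm.ρ₁_pos) (pow_pos prm.c₀_pos 2)

theorem density_pos (c : ℝ) : 0 < density prm c := by
  unfold density
  have h0 : 0 ≤ min (max c 0) 1 := le_min (le_max_right _ _) zero_le_one
  have h1 : min (max c 0) 1 ≤ 1 := min_le_right _ _
  rcases h0.eq_or_lt with h | h
  · rw [← h]; simpa using prm.ρ₂_pos
  · exact add_pos_of_pos_of_nonneg (mul_pos prm.ρ₁_pos h)
      (mul_nonneg prm.ρ₂_pos.le (sub_nonneg.2 h1))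

theorem NodalData.rho_pos (x : NodalData) : 0 < x.rho prm := density_pos prm _

theorem dotNormal_apply (n : Fin 3 → ℝ) (F : Fin 3 → Fin 5 → ℝ) (k : Fin 5) :
    dotNormal n F k = ∑ d, n d * F d k := by
  simp [dotNormal, Finset.sum_apply]

theorem dotNormal_neg (n : Fin 3 → ℝ) (F : Fin 3 → Fin 5 → ℝ) (k : Fin 5) :
    dotNormal (-n) F k = -dotNormal n F k := by
  simp [dotNormal_apply]

namespace NodalData

variable (x : NodalData)

/-- The coefficients of the non-conservative terms, contracted with the entropy variables, give the
inviscid flux. -/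
theorem sum_W_mul_Phi (m : Fin 5) (d : Fin 3) :
    ∑ k, x.W prm k * x.Phi prm m d k = x.Fe prm d m := by
  have hm := (acModulus_pos prm).ne'
  fin_cases m <;> fin_cases d <;>
    simp [Fin.sum_univ_five, W, Phi, Fe] <;> field_simp

theorem sum_W_mul_dotNormal_Phi (n : Fin 3 → ℝ) (m : Fin 5) :
    ∑ k, x.W prm k * dotNormal n (x.Phi prm m) k = dotNormal n (x.Fe prm) m := by
  simp only [dotNormal_apply, Finset.mul_sum, ← sum_W_mul_Phi]
  rw [Finset.sum_comm]
  exact Finset.sum_congr rfl fun d _ => Finset.sum_congr rfl fun k _ => by ring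

theorem dotNormal_Fe (n : Fin 3 → ℝ) : dotNormal n (x.Fe prm)
    = mkState (x.C * x.Un prm n)
      (fun i => 1 / 2 * x.rho prm * x.Un prm n * x.U prm i + x.P * n i) 0 := by
  ext k
  rw [dotNormal_apply]
  fin_cases k <;> simp [Fin.sum_univ_three, Fe, Un] <;> ring

/-- The viscous flux contracted with the discrete gradients is the dissipation. -/
theorem sum_G_mul_Fv : ∑ d, ∑ k, x.G d k * x.Fv prm d k = x.dissipation prm := by
  simp [Fin.sum_univ_five, Fin.sum_univ_three, Fv, dissipation, strain]
  ring

end NodalData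

/-- Entropy production at a boundary node of an element: `ct` and `cst` are the time derivatives of
the local and of the numerical value of the concentration. -/
noncomputable def boundaryProduction (x : NodalData) (F : NumericalTrace) (n : Fin 3 → ℝ)
    (ct cst : ℝ) : ℝ :=
  ∑ k, (x.W prm k * F.FvN k + (F.W k - x.W prm k) * dotNormal n (x.Fv prm) k)
    - ∑ k, x.W prm k * (F.FeN k + F.diamondN k - dotNormal n (x.Fe prm) k)
    + 3 / 2 * prm.σ * prm.ε * (ct * F.GcN + (cst - ct) * ∑ d, x.Gc d * n d)

/-- By the contraction identity the diamond term becomes the averaged `W` paired with the local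
flux, so the total is a polarised form of the pairing of `W` with the flux. -/
theorem sum_W_mul_central (L R x : NodalData) (n : Fin 3 → ℝ) :
    ∑ k, x.W prm k * (inviscidStar prm .central L R n k + diamondFlux prm .central L R x n k)
      = 1 / 2 * ∑ k, (x.W prm k * (dotNormal n (L.Fe prm) k + dotNormal n (R.Fe prm) k)
        + (L.W prm k + R.W prm k) * dotNormal n (x.Fe prm) k) := by
  have h : ∑ k, x.W prm k * diamondFlux prm .central L R x n k
      = ∑ m, (L.W prm m + R.W prm m) / 2 * dotNormal n (x.Fe prm) m := by
    simp only [diamondFlux, Finset.sum_apply, Pi.smul_apply, smul_eq_mul, Finset.mul_sum,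
      ← NodalData.sum_W_mul_dotNormal_Phi]
    rw [Finset.sum_comm]
    exact Finset.sum_congr rfl fun d _ => Finset.sum_congr rfl fun k _ => by ring
  simp only [mul_add, Finset.sum_add_distrib] at h ⊢
  rw [h]
  simp only [inviscidStar, Pi.smul_apply, smul_eq_mul, Pi.add_apply, Finset.mul_sum,
    ← Finset.sum_add_distrib]
  exact Finset.sum_congr rfl fun k _ => by ring

/-- Once the local flux is subtracted, each side contributes half of `W_L · F_R + W_R · F_L`, which
is symmetric in the two states. -/
theorem central_interior (L R : NodalData) (n : Fin 3 → ℝ) :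
    ∑ k, L.W prm k * (inviscidStar prm .central L R n k + diamondFlux prm .central L R L n k
        - dotNormal n (L.Fe prm) k)
      - ∑ k, R.W prm k * (inviscidStar prm .central L R n k + diamondFlux prm .central L R R n k
        - dotNormal n (R.Fe prm) k) = 0 := by
  simp only [mul_sub _ _ (dotNormal _ _ _), Finset.sum_sub_distrib, sum_W_mul_central]
  simp only [Finset.mul_sum, ← Finset.sum_sub_distrib]
  exact Finset.sum_eq_zero fun k _ => by ring

theorem abs_Un_lt_soundSpeed (x : NodalData) (n : Fin 3 → ℝ) :
    |x.Un prm n| < soundSpeed prm x n := by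
  refine Real.lt_sqrt_of_sq_lt ?_
  have := div_pos (mul_pos four_pos (acModulus_pos prm)) (x.rho_pos prm)
  rw [sq_abs]
  linarith

theorem lamPlus_pos (x : NodalData) (n : Fin 3 → ℝ) : 0 < lamPlus prm x n := by
  have := abs_lt.1 (abs_Un_lt_soundSpeed prm x n)
  unfold lamPlus
  linarith

theorem lamMinus_neg (x : NodalData) (n : Fin 3 → ℝ) : lamMinus prm x n < 0 := by
  have := abs_lt.1 (abs_Un_lt_soundSpeed prm x n)
  unfold lamMinus
  linarith

theorem riemann_denominator_pos (L R : NodalData) (n : Fin 3 → ℝ) :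
    0 < L.rho prm * lamPlus prm L n - R.rho prm * lamMinus prm R n := by
  have h1 := mul_pos (L.rho_pos prm) (lamPlus_pos prm L n)
  have h2 := mul_neg_of_pos_of_neg (R.rho_pos prm) (lamMinus_neg prm R n)
  linarith

/-- `starU` is exactly the velocity at which the pressures reached from the left and from the right
coincide; each half of the Riemann estimate uses its own expression. -/
theorem starP_eq_right (L R : NodalData) (n : Fin 3 → ℝ) :
    starP prm L R n
      = R.P + R.rho prm * lamMinus prm R n * (R.Un prm n - starU prm L R n) := by
  have h := div_mul_cancel₀ (L.P - R.P + L.rho prm * L.Un prm n * lamPlus prm L n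
    - R.rho prm * R.Un prm n * lamMinus prm R n) (riemann_denominator_pos prm L R n).ne'
  rw [← starU] at h
  unfold starP
  linear_combination -h

/-- The star-region velocity vector. -/
noncomputable def starV (L R : NodalData) (n : Fin 3 → ℝ) (i : Fin 3) : ℝ :=
  starU prm L R n * n i + starVt prm L R n i

/-- The momentum terms are rearranged into squares: the velocity dependence enters through the
distance of `starV` from the local velocity. The square of `starV` itself is common to both sides of
a face and cancels in the difference. -/
theorem sum_W_mul_riemann (L R x : NodalData) (n : Fin 3 → ℝ) :
    ∑ k, x.W prm k * (inviscidStar prm .exactRiemann L R n k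
        + diamondFlux prm .exactRiemann L R x n k - dotNormal n (x.Fe prm) k)
      = x.μ * ((L.C * L.Un prm n + R.C * R.Un prm n) / 2)
        + x.C * x.Un prm n * ((L.μ + R.μ) / 2) - x.μ * x.C * x.Un prm n
        + 1 / 2 * (starRho prm L R n * starU prm L R n)
          * (∑ i, starV prm L R n i ^ 2 - ∑ i, (starV prm L R n i - x.U prm i) ^ 2)
        + starP prm L R n * x.Un prm n + x.P * (starU prm L R n - x.Un prm n) := by
  have hm := (acModulus_pos prm).ne'
  have h5 : x.P / acModulus prm * (acModulus prm * starU prm L R n) = x.P * starU prm L R n := by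
    field_simp
  rw [NodalData.dotNormal_Fe]
  simp only [inviscidStar, diamondFlux, NodalData.W, Fin.sum_univ_five, mkState_zero, mkState_one,
    mkState_two, mkState_three, mkState_four, Fin.sum_univ_three, starV]
  rw [zero_add, sub_zero, h5]
  generalize starU prm L R n = us
  generalize starP prm L R n = ps
  generalize starRho prm L R n = rs
  generalize starVt prm L R n = vs
  generalize (L.C * L.Un prm n + R.C * R.Un prm n) / 2 = cu
  generalize (L.μ + R.μ) / 2 = ms
  have hU : x.Un prm n = x.U prm 0 * n 0 + x.U prm 1 * n 1 + x.U prm 2 * n 2 := by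
    rw [NodalData.Un, Fin.sum_univ_three]
  linear_combination (-(ps) + x.P - x.C * ms) * hU

/-- On the upwind side the tangential velocity is that of the star state, so the two velocities
differ only along the unit normal. -/
theorem sum_starV_sub_sq (L R x : NodalData) (n : Fin 3 → ℝ) (hn : ∑ i, n i ^ 2 = 1)
    (h : starVt prm L R n = x.Vt prm n) :
    ∑ i, (starV prm L R n i - x.U prm i) ^ 2 = (starU prm L R n - x.Un prm n) ^ 2 := by
  have : ∀ i, (starV prm L R n i - x.U prm i) ^ 2
      = (starU prm L R n - x.Un prm n) ^ 2 * n i ^ 2 := by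
    intro i
    rw [starV, h, NodalData.Vt]
    ring
  simp only [this, ← Finset.mul_sum, hn, mul_one]

theorem riemann_interior (L R : NodalData) (n : Fin 3 → ℝ) (hn : ∑ i, n i ^ 2 = 1) :
    0 ≤ ∑ k, L.W prm k * (inviscidStar prm .exactRiemann L R n k
        + diamondFlux prm .exactRiemann L R L n k - dotNormal n (L.Fe prm) k)
      - ∑ k, R.W prm k * (inviscidStar prm .exactRiemann L R n k
        + diamondFlux prm .exactRiemann L R R n k - dotNormal n (R.Fe prm) k) := by
  rw [sum_W_mul_riemann, sum_W_mul_riemann]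
  have hL : starP prm L R n
    = L.P + L.rho prm * lamPlus prm L n * (L.Un prm n - starU prm L R n) := rfl
  have hR := starP_eq_right prm L R n
  set us := starU prm L R n with hus
  set A := L.rho prm * lamPlus prm L n with hA
  set B := R.rho prm * lamMinus prm R n with hB
  have hA0 : 0 < A := mul_pos (L.rho_pos prm) (lamPlus_pos prm L n)
  have hB0 : B < 0 := mul_neg_of_pos_of_neg (R.rho_pos prm) (lamMinus_neg prm R n)
  set DL := ∑ i, (starV prm L R n i - L.U prm i) ^ 2 with hDL
  set DR := ∑ i, (starV prm L R n i - R.U prm i) ^ 2 with hDR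
  have hDL0 : 0 ≤ DL := Finset.sum_nonneg fun _ _ => sq_nonneg _
  have hDR0 : 0 ≤ DR := Finset.sum_nonneg fun _ _ => sq_nonneg _
  -- The star mass flux is `A q` or `B q` with `q` in `[0,1]`, according to the sign of `us`. The
  -- only bad term is then half the upwind squared distance times this flux; it is absorbed by the
  -- full quadratic term with factor `A` or `-B` on the same side.
  have key : 0 ≤ 1 / 2 * (starRho prm L R n * us) * (DR - DL)
      + A * (us - L.Un prm n) ^ 2 - B * (us - R.Un prm n) ^ 2 := by
    by_cases h : 0 ≤ us
    · have hV : starVt prm L R n = L.Vt prm n := by rw [starVt, if_pos h]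
      have h1 : DL = (us - L.Un prm n) ^ 2 := sum_starV_sub_sq prm L R L n hn hV
      have hl := lamMinus_neg prm L n
      have h2 : starRho prm L R n * us = A * (us / (us - lamMinus prm L n)) := by
        rw [starRho, if_pos h]
        ring
      have h3 : us / (us - lamMinus prm L n) ≤ 1 := by
        rw [div_le_one (by linarith)]; linarith
      have h4 : 0 ≤ us / (us - lamMinus prm L n) := div_nonneg h (by linarith)
      rw [h2]
      set q := us / (us - lamMinus prm L n)
      have e1 : 0 ≤ A * q * DR := by positivity
      have e2 : 0 ≤ A * ((1 - q) * DL) :=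
        mul_nonneg hA0.le (mul_nonneg (by linarith) hDL0)
      have e3 : 0 ≤ -B * (us - R.Un prm n) ^ 2 := mul_nonneg (by linarith) (sq_nonneg _)
      have e4 : 0 ≤ A * DL := by positivity
      rw [← h1]
      linarith
    · have hV : starVt prm L R n = R.Vt prm n := by rw [starVt, if_neg h]
      have h1 : DR = (us - R.Un prm n) ^ 2 := sum_starV_sub_sq prm L R R n hn hV
      have hl := lamPlus_pos prm R n
      push Not at h
      have h2 : starRho prm L R n * us = B * (us / (us - lamPlus prm R n)) := by
        rw [starRho, if_neg (not_le.2 h)]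
        ring
      have h3 : us / (us - lamPlus prm R n) ≤ 1 := by
        rw [div_le_one_of_neg (by linarith)]; linarith
      have h4 : 0 ≤ us / (us - lamPlus prm R n) := div_nonneg_of_nonpos h.le (by linarith)
      rw [h2]
      set q := us / (us - lamPlus prm R n)
      have e1 : 0 ≤ (-B) * q * DL := mul_nonneg (mul_nonneg (by linarith) h4) hDL0
      have e2 : 0 ≤ (-B) * ((1 - q) * DR) :=
        mul_nonneg (by linarith) (mul_nonneg (by linarith) hDR0)
      have e3 : 0 ≤ A * (us - L.Un prm n) ^ 2 := mul_nonneg hA0.le (sq_nonneg _)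
      have e4 : 0 ≤ (-B) * DR := mul_nonneg (by linarith) hDR0
      rw [← h1]
      linarith
  -- The quadratic terms are the pressure work: `hL` is used against the left velocity defect and
  -- `hR` against the right one.
  refine key.trans (le_of_eq ?_)
  linear_combination (us - L.Un prm n) * hL - (us - R.Un prm n) * hR

theorem ghost_C (x : NodalData) (n : Fin 3 → ℝ) : (x.ghost n).C = x.C := rfl

theorem ghost_P (x : NodalData) (n : Fin 3 → ℝ) : (x.ghost n).P = x.P := rfl

theorem ghost_rho (x : NodalData) (n : Fin 3 → ℝ) : (x.ghost n).rho prm = x.rho prm := rfl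

/-- The mirror acts on `√ρ U`; since the concentration is kept, the density is the same and the
velocity itself is mirrored. -/
theorem ghost_U (x : NodalData) (n : Fin 3 → ℝ) (i : Fin 3) :
    (x.ghost n).U prm i = x.U prm i - 2 * x.Un prm n * n i := by
  have h : (x.ghost n).Q (spIdx i) = x.Q (spIdx i) - 2 * (∑ j, x.Q (spIdx j) * n j) * n i := by
    fin_cases i <;> rfl
  have h2 : x.Un prm n = (∑ j, x.Q (spIdx j) * n j) / Real.sqrt (x.rho prm) := by
    rw [NodalData.Un, Finset.sum_div]
    exact Finset.sum_congr rfl fun j _ => by rw [NodalData.U]; ring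
  rw [NodalData.U, ghost_rho, h, h2, NodalData.U]
  ring

theorem ghost_Un (x : NodalData) (n : Fin 3 → ℝ) (hn : ∑ i, n i ^ 2 = 1) :
    (x.ghost n).Un prm n = -x.Un prm n := by
  have : (x.ghost n).Un prm n = x.Un prm n - 2 * x.Un prm n * ∑ i, n i ^ 2 := by
    rw [NodalData.Un, Finset.mul_sum]
    conv_rhs => lhs; rw [NodalData.Un]
    rw [← Finset.sum_sub_distrib]
    exact Finset.sum_congr rfl fun i _ => by rw [ghost_U]; ring
  rw [this, hn]
  ring

/-- What remains is half of `W · F_ghost + W_ghost · F`. The convective parts are odd in the normal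
velocity and cancel, and so do the two pressure works. -/
theorem central_wall (x : NodalData) (n : Fin 3 → ℝ) (hn : ∑ i, n i ^ 2 = 1) :
    ∑ k, x.W prm k * (inviscidStar prm .central x (x.ghost n) n k
        + diamondFlux prm .central x (x.ghost n) x n k - dotNormal n (x.Fe prm) k) = 0 := by
  simp only [mul_sub _ _ (dotNormal _ _ _), Finset.sum_sub_distrib, sum_W_mul_central]
  have hμ : (x.ghost n).μ = x.μ := rfl
  have hU := ghost_Un prm x n hn
  have hU' : (x.ghost n).U prm 0 * n 0 + (x.ghost n).U prm 1 * n 1 + (x.ghost n).U prm 2 * n 2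
      = -(x.U prm 0 * n 0 + x.U prm 1 * n 1 + x.U prm 2 * n 2) := by
    simpa [NodalData.Un, Fin.sum_univ_three] using hU
  simp only [NodalData.dotNormal_Fe, NodalData.W, Fin.sum_univ_five, mkState_zero, mkState_one,
    mkState_two, mkState_three, mkState_four, hU, ghost_C, ghost_P, ghost_rho, hμ]
  linear_combination (x.P / 2) * hU'

/-- Mirroring keeps pressure, density and sound speed, and sends `λ⁻` to minus `λ⁺`, so the
numerator cancels. -/
theorem starU_ghost (x : NodalData) (n : Fin 3 → ℝ) (hn : ∑ i, n i ^ 2 = 1) :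
    starU prm x (x.ghost n) n = 0 := by
  have hs : soundSpeed prm (x.ghost n) n = soundSpeed prm x n := by
    rw [soundSpeed, soundSpeed, ghost_Un prm x n hn, ghost_rho, neg_sq]
  rw [starU, div_eq_zero_iff]
  left
  rw [ghost_P, ghost_rho, ghost_Un prm x n hn, lamPlus, lamMinus, hs, ghost_Un prm x n hn]
  ring

/-- With zero star velocity only the excess star pressure does work, which equals `ρ λ⁺ U_n²`. -/
theorem riemann_wall (x : NodalData) (n : Fin 3 → ℝ) (hn : ∑ i, n i ^ 2 = 1) :
    0 ≤ ∑ k, x.W prm k * (inviscidStar prm .exactRiemann x (x.ghost n) n k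
        + diamondFlux prm .exactRiemann x (x.ghost n) x n k - dotNormal n (x.Fe prm) k) := by
  have hμ : (x.ghost n).μ = x.μ := rfl
  rw [sum_W_mul_riemann, starP, starU_ghost prm x n hn, ghost_Un prm x n hn, ghost_C, hμ]
  have h : 0 ≤ x.rho prm * lamPlus prm x n * x.Un prm n ^ 2 :=
    mul_nonneg (mul_pos (x.rho_pos prm) (lamPlus_pos prm x n)).le (sq_nonneg _)
  linarith

theorem inviscid_interior (k : InviscidFlux) (L R : NodalData) (n : Fin 3 → ℝ)
    (hn : ∑ i, n i ^ 2 = 1) :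
    0 ≤ ∑ j, L.W prm j * (inviscidStar prm k L R n j + diamondFlux prm k L R L n j
        - dotNormal n (L.Fe prm) j)
      - ∑ j, R.W prm j * (inviscidStar prm k L R n j + diamondFlux prm k L R R n j
        - dotNormal n (R.Fe prm) j) := by
  cases k
  · exact (central_interior prm L R n).ge
  · exact riemann_interior prm L R n hn

theorem inviscid_wall (k : InviscidFlux) (x : NodalData) (n : Fin 3 → ℝ)
    (hn : ∑ i, n i ^ 2 = 1) :
    0 ≤ ∑ j, x.W prm j * (inviscidStar prm k x (x.ghost n) n j
        + diamondFlux prm k x (x.ghost n) x n j - dotNormal n (x.Fe prm) j) := by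
  cases k
  · exact (central_wall prm x n hn).ge
  · exact riemann_wall prm x n hn

/-- The entropy production at a node of an interior face. -/
theorem boundaryProduction_interior (k : InviscidFlux) (β : ℝ) (L R : NodalData) (n : Fin 3 → ℝ)
    (ctL ctR : ℝ) :
    boundaryProduction prm L (leftTrace prm k β L R n) n ctL ((ctL + ctR) / 2)
      + boundaryProduction prm R (rightTrace prm k β L R n) (-n) ctR ((ctL + ctR) / 2)
      + 3 / 2 * prm.σ * prm.ε * (β * (R.C - L.C) * (ctR - ctL))
    = -(β * (R.μ - L.μ) ^ 2)
      - (∑ j, L.W prm j * (inviscidStar prm k L R n j + diamondFlux prm k L R L n j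
          - dotNormal n (L.Fe prm) j)
        - ∑ j, R.W prm j * (inviscidStar prm k L R n j + diamondFlux prm k L R R n j
          - dotNormal n (R.Fe prm) j)) := by
  have h1 : ∑ j, R.W prm j * ((rightTrace prm k β L R n).FeN j
        + (rightTrace prm k β L R n).diamondN j - dotNormal (-n) (R.Fe prm) j)
      = -∑ j, R.W prm j * (inviscidStar prm k L R n j + diamondFlux prm k L R R n j
          - dotNormal n (R.Fe prm) j) := by
    rw [← Finset.sum_neg_distrib]
    refine Finset.sum_congr rfl fun j _ => ?_
    rw [dotNormal_neg]
    simp only [rightTrace, Pi.neg_apply]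
    ring
  have h2 : ∑ j, (L.W prm j * (leftTrace prm k β L R n).FvN j
        + ((leftTrace prm k β L R n).W j - L.W prm j) * dotNormal n (L.Fv prm) j)
      + ∑ j, (R.W prm j * (rightTrace prm k β L R n).FvN j
        + ((rightTrace prm k β L R n).W j - R.W prm j) * dotNormal (-n) (R.Fv prm) j)
      = -(β * (R.μ - L.μ) ^ 2) := by
    simp only [leftTrace, rightTrace, viscousStar, dotNormal_neg, Pi.add_apply, Pi.neg_apply,
      Pi.smul_apply, smul_eq_mul, Fin.sum_univ_five, mkState_zero, mkState_one, mkState_two,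
      mkState_three, mkState_four, Pi.zero_apply]
    have hL : L.W prm 0 = L.μ := rfl
    have hR : R.W prm 0 = R.μ := rfl
    rw [hL, hR]
    ring
  have h3 : (leftTrace prm k β L R n).GcN = gradCStar β L R n := rfl
  have h4 : (rightTrace prm k β L R n).GcN = -gradCStar β L R n := rfl
  unfold boundaryProduction
  rw [h1, h3, h4, ← h2]
  simp only [leftTrace, gradCStar, Fin.sum_univ_three, Pi.neg_apply]
  ring

/-- The entropy production at a node of a wall. -/
theorem boundaryProduction_wall (k : InviscidFlux) (b : WallType) (fw : ℝ → ℝ) (x : NodalData)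
    (n : Fin 3 → ℝ) (ct : ℝ) :
    boundaryProduction prm x (wallTrace prm k b fw x n) n ct ct + deriv fw x.C * ct
    = -∑ j, x.W prm j * (inviscidStar prm k x (x.ghost n) n j
        + diamondFlux prm k x (x.ghost n) x n j - dotNormal n (x.Fe prm) j) := by
  have h1 : ∑ j, (x.W prm j * (wallTrace prm k b fw x n).FvN j
        + ((wallTrace prm k b fw x n).W j - x.W prm j) * dotNormal n (x.Fv prm) j) = 0 := by
    cases b
    · simp [wallTrace]
    · simp [wallTrace, Fin.sum_univ_five, Fin.sum_univ_three, dotNormal_apply, NodalData.W,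
        NodalData.Fv]
      ring
  have hσ := prm.σ_pos.ne'
  have hε := prm.ε_pos.ne'
  unfold boundaryProduction
  rw [h1]
  simp only [wallTrace]
  field_simp
  ring

end Fluxes
end INSCH

namespace INSCH

/-! ### Balances on a single element. -/

section Elements

variable {N : ℕ} {gl : GaussLobatto N} {Elem IFace BFace : Type*}

theorem refDeriv_add (gl : GaussLobatto N) (i : Fin 3) (f g : Node N → ℝ) (ν : Node N) :
    refDeriv gl i (fun κ => f κ + g κ) ν = refDeriv gl i f ν + refDeriv gl i g ν := by
  simp only [refDeriv, mul_add, Finset.sum_add_distrib]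

theorem refDeriv_const_mul (gl : GaussLobatto N) (i : Fin 3) (c : ℝ) (f : Node N → ℝ)
    (ν : Node N) : refDeriv gl i (fun κ => c * f κ) ν = c * refDeriv gl i f ν := by
  rw [refDeriv, refDeriv, Finset.mul_sum]
  exact Finset.sum_congr rfl fun _ _ => by ring

theorem volQuad_hasDerivWithinAt (gl : GaussLobatto N) {f : ℝ → Node N → ℝ} {f' : Node N → ℝ}
    {s : Set ℝ} {t : ℝ} (h : ∀ ν, HasDerivWithinAt (fun τ => f τ ν) (f' ν) s t) :
    HasDerivWithinAt (fun τ => volQuad gl (f τ)) (volQuad gl f') s t :=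
  HasDerivWithinAt.fun_sum fun ν _ => (h ν).const_mul _

theorem faceQuad_hasDerivWithinAt (gl : GaussLobatto N) {f : ℝ → FaceNode N → ℝ}
    {f' : FaceNode N → ℝ} {s : Set ℝ} {t : ℝ}
    (h : ∀ a, HasDerivWithinAt (fun τ => f τ a) (f' a) s t) :
    HasDerivWithinAt (fun τ => faceQuad gl (f τ)) (faceQuad gl f') s t :=
  HasDerivWithinAt.fun_sum fun a _ => (h a).const_mul _

namespace HexMesh

variable (mesh : HexMesh gl Elem IFace BFace)

theorem sideIntegral_hasDerivWithinAt (z : Elem × Side) {f : ℝ → FaceNode N → ℝ}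
    {f' : FaceNode N → ℝ} {s : Set ℝ} {t : ℝ}
    (h : ∀ a, HasDerivWithinAt (fun τ => f τ a) (f' a) s t) :
    HasDerivWithinAt (fun τ => mesh.sideIntegral z (f τ)) (mesh.sideIntegral z f') s t :=
  faceQuad_hasDerivWithinAt gl fun a => (h a).const_mul _

theorem sideIntegral_add (z : Elem × Side) (f g : FaceNode N → ℝ) :
    mesh.sideIntegral z (fun a => f a + g a) = mesh.sideIntegral z f + mesh.sideIntegral z g := by
  simp only [sideIntegral, mul_add, faceQuad_add]

theorem sideIntegral_sub (z : Elem × Side) (f g : FaceNode N → ℝ) :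
    mesh.sideIntegral z (fun a => f a - g a) = mesh.sideIntegral z f - mesh.sideIntegral z g := by
  simp only [sideIntegral, mul_sub, faceQuad_sub]

theorem sideIntegral_const_mul (z : Elem × Side) (c : ℝ) (f : FaceNode N → ℝ) :
    mesh.sideIntegral z (fun a => c * f a) = c * mesh.sideIntegral z f := by
  simp only [sideIntegral, ← faceQuad_const_mul]
  congr 1
  ext a
  ring

theorem boundaryIntegral_add (e : Elem) (f g : Side → FaceNode N → ℝ) :
    mesh.boundaryIntegral e (fun s a => f s a + g s a)
      = mesh.boundaryIntegral e f + mesh.boundaryIntegral e g := by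
  simp only [boundaryIntegral, sideIntegral_add, Finset.sum_add_distrib]

theorem boundaryIntegral_sub (e : Elem) (f g : Side → FaceNode N → ℝ) :
    mesh.boundaryIntegral e (fun s a => f s a - g s a)
      = mesh.boundaryIntegral e f - mesh.boundaryIntegral e g := by
  simp only [boundaryIntegral, sideIntegral_sub, Finset.sum_sub_distrib]

theorem boundaryIntegral_const_mul (e : Elem) (c : ℝ) (f : Side → FaceNode N → ℝ) :
    mesh.boundaryIntegral e (fun s a => c * f s a) = c * mesh.boundaryIntegral e f := by
  simp only [boundaryIntegral, sideIntegral_const_mul, Finset.mul_sum]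

theorem faceJacobian_mul_normal (e : Elem) (s : Side) (a : FaceNode N) (v : Fin 3 → ℝ) :
    faceJacobian gl (mesh.coord e) s a * ∑ d, mesh.normal (e, s) a d * v d
      = sideSign s * mesh.contra e (faceNode s a) s.1 v := by
  simp only [contra, Finset.mul_sum, ← mul_assoc, ← faceJacobian_mul_outwardNormal]
  rfl

/-- The volume terms of the inviscid operator, tested with the entropy variables, reduce to the
boundary. -/
theorem inviscid_volume (prm : Params) (x : Node N → NodalData) (e : Elem) :
    volQuad gl (fun ν => ∑ k, (x ν).W prm k *
        ∑ i, refDeriv gl i (fun κ => mesh.contra e κ i (fun d => (x κ).Fe prm d k)) ν)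
      + ∑ m, volQuad gl (fun ν => ∑ k, (x ν).W prm k *
        ∑ i, mesh.contra e ν i (fun d => (x ν).Phi prm m d k)
          * refDeriv gl i (fun κ => (x κ).W prm m) ν)
    = mesh.boundaryIntegral e (fun s a => ∑ k, (x (faceNode s a)).W prm k
        * dotNormal (mesh.normal (e, s) a) ((x (faceNode s a)).Fe prm) k) := by
  -- Contracting the non-conservative term with `W` turns it into the flux paired with the
  -- derivative of `W`, the second half of the product rule.
  have h1 : ∀ m ν, ∑ k, (x ν).W prm k * ∑ i, mesh.contra e ν i (fun d => (x ν).Phi prm m d k)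
          * refDeriv gl i (fun κ => (x κ).W prm m) ν
      = ∑ i, refDeriv gl i (fun κ => (x κ).W prm m) ν
          * mesh.contra e ν i (fun d => (x ν).Fe prm d m) := by
    intro m ν
    simp only [contra, ← NodalData.sum_W_mul_Phi, Finset.mul_sum, Finset.sum_mul]
    rw [Finset.sum_comm]
    refine Finset.sum_congr rfl fun i _ => ?_
    rw [Finset.sum_comm]
    exact Finset.sum_congr rfl fun d _ => Finset.sum_congr rfl fun k _ => by ring
  have h2 : ∀ s : Side, mesh.sideIntegral (e, s) (fun a => ∑ k, (x (faceNode s a)).W prm k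
        * dotNormal (mesh.normal (e, s) a) ((x (faceNode s a)).Fe prm) k)
      = ∑ k, faceQuad gl (fun a => sideSign s * ((x (faceNode s a)).W prm k
          * mesh.contra e (faceNode s a) s.1 (fun d => (x (faceNode s a)).Fe prm d k))) := by
    intro s
    simp only [sideIntegral, faceQuad]
    rw [Finset.sum_comm]
    refine Finset.sum_congr rfl fun a _ => ?_
    rw [← Finset.mul_sum]
    congr 1
    rw [Finset.mul_sum]
    refine Finset.sum_congr rfl fun k _ => ?_
    rw [dotNormal_apply]
    linear_combination (x (faceNode s a)).W prm k * mesh.faceJacobian_mul_normal e s a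
      (fun d => (x (faceNode s a)).Fe prm d k)
  simp only [h1, boundaryIntegral, h2]
  rw [Fintype.sum_prod_type]
  have h3 : ∀ i : Fin 3, ∑ b : Bool, ∑ k, faceQuad gl (fun a => sideSign (i, b)
        * ((x (faceNode (i, b) a)).W prm k
          * mesh.contra e (faceNode (i, b) a) (i, b).1
            (fun d => (x (faceNode (i, b) a)).Fe prm d k)))
      = ∑ k, (volQuad gl (fun ν => (x ν).W prm k
            * refDeriv gl i (fun κ => mesh.contra e κ i (fun d => (x κ).Fe prm d k)) ν)
          + volQuad gl (fun ν => refDeriv gl i (fun κ => (x κ).W prm k) ν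
            * mesh.contra e ν i (fun d => (x ν).Fe prm d k))) := by
    intro i
    rw [Finset.sum_comm]
    exact Finset.sum_congr rfl fun k _ => (volQuad_by_parts gl i (fun ν => (x ν).W prm k)
      (fun κ => mesh.contra e κ i (fun d => (x κ).Fe prm d k))).symm
  rw [Finset.sum_congr rfl fun i _ => h3 i]
  simp only [Finset.mul_sum, volQuad_sum, Finset.sum_add_distrib]
  congr 1
  · exact Finset.sum_comm
  · exact Finset.sum_comm

/-- The state equation tested with the entropy variables, combined with the gradient equation tested
with the viscous fluxes. -/
theorem kinetic_balance (S : Scheme N IFace BFace) (u : Elem → Node N → NodalData)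
    (Qt : Elem → Node N → Fin 5 → ℝ) (e : Elem)
    (hs : ∀ φ, mesh.StateEq S u Qt e φ) (hg : ∀ φ, mesh.GradientEq S u e φ) :
    volQuad gl (fun ν => mesh.J e ν * ∑ k, (u e ν).mass S.prm k * Qt e ν k * (u e ν).W S.prm k)
    = -volQuad gl (fun ν => mesh.J e ν * (u e ν).dissipation S.prm)
      + mesh.boundaryIntegral e (fun s a =>
        ∑ k, ((trace u (e, s) a).W S.prm k * (mesh.numericalTrace S u (e, s) a).FvN k
          + ((mesh.numericalTrace S u (e, s) a).W k - (trace u (e, s) a).W S.prm k)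
            * dotNormal (mesh.normal (e, s) a) ((trace u (e, s) a).Fv S.prm) k))
      - mesh.boundaryIntegral e (fun s a =>
        ∑ k, (trace u (e, s) a).W S.prm k * ((mesh.numericalTrace S u (e, s) a).FeN k
          + (mesh.numericalTrace S u (e, s) a).diamondN k
          - dotNormal (mesh.normal (e, s) a) ((trace u (e, s) a).Fe S.prm) k)) := by
  have h1 := hs (fun ν k => (u e ν).W S.prm k)
  have h2 := hg (fun ν d k => (u e ν).Fv S.prm d k)
  have h3 := mesh.inviscid_volume S.prm (u e) e
  unfold StateEq at h1
  unfold GradientEq at h2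
  simp only [NodalData.sum_G_mul_Fv] at h2
  -- The local part of the diamond term contracts to a second copy of the inviscid flux. One of the
  -- two copies is cancelled by the boundary term of `inviscid_volume`.
  have h4 : ∀ (s : Side) (a : FaceNode N), ∑ k, (u e (faceNode s a)).W S.prm k *
          ((mesh.numericalTrace S u (e, s) a).FeN k
            - dotNormal (mesh.normal (e, s) a) ((trace u (e, s) a).Fe S.prm) k
            + ((mesh.numericalTrace S u (e, s) a).diamondN k
              - ∑ m, dotNormal (mesh.normal (e, s) a) ((trace u (e, s) a).Phi S.prm m) k
                * (trace u (e, s) a).W S.prm m))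
      = ∑ k, (trace u (e, s) a).W S.prm k * ((mesh.numericalTrace S u (e, s) a).FeN k
          + (mesh.numericalTrace S u (e, s) a).diamondN k
          - dotNormal (mesh.normal (e, s) a) ((trace u (e, s) a).Fe S.prm) k)
        - ∑ k, (u e (faceNode s a)).W S.prm k
        * dotNormal (mesh.normal (e, s) a) ((u e (faceNode s a)).Fe S.prm) k := by
    intro s a
    have ht : trace u (e, s) a = u e (faceNode s a) := rfl
    have h5 : ∑ k, (u e (faceNode s a)).W S.prm k
          * ∑ m, dotNormal (mesh.normal (e, s) a) ((u e (faceNode s a)).Phi S.prm m) k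
            * (u e (faceNode s a)).W S.prm m
        = ∑ m, (u e (faceNode s a)).W S.prm m
          * dotNormal (mesh.normal (e, s) a) ((u e (faceNode s a)).Fe S.prm) m := by
      simp only [← NodalData.sum_W_mul_dotNormal_Phi, Finset.mul_sum]
      rw [Finset.sum_comm]
      exact Finset.sum_congr rfl fun _ _ => Finset.sum_congr rfl fun _ _ => by ring
    rw [ht]
    conv_rhs => rw [← h5]
    rw [← Finset.sum_sub_distrib]
    exact Finset.sum_congr rfl fun k _ => by ring
  simp only [h4, boundaryIntegral_sub] at h1
  have h6 : mesh.boundaryIntegral e (fun s a =>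
        ∑ k, ((trace u (e, s) a).W S.prm k * (mesh.numericalTrace S u (e, s) a).FvN k
          + ((mesh.numericalTrace S u (e, s) a).W k - (trace u (e, s) a).W S.prm k)
            * dotNormal (mesh.normal (e, s) a) ((trace u (e, s) a).Fv S.prm) k))
      = mesh.boundaryIntegral e (fun s a =>
        ∑ k, (u e (faceNode s a)).W S.prm k * (mesh.numericalTrace S u (e, s) a).FvN k)
      + mesh.boundaryIntegral e (fun s a =>
        ∑ k, ((mesh.numericalTrace S u (e, s) a).W k - (trace u (e, s) a).W S.prm k)
            * dotNormal (mesh.normal (e, s) a) ((trace u (e, s) a).Fv S.prm) k) := by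
    rw [← boundaryIntegral_add]
    simp only [Finset.sum_add_distrib]
    rfl
  rw [h6]
  have h7 : mesh.boundaryIntegral e (fun s a =>
        ∑ k, ((mesh.numericalTrace S u (e, s) a).W k - (trace u (e, s) a).W S.prm k)
            * dotNormal (mesh.normal (e, s) a) ((trace u (e, s) a).Fv S.prm) k)
      = mesh.boundaryIntegral e (fun s a =>
        ∑ k, ((mesh.numericalTrace S u (e, s) a).W k - (trace u (e, s) a).W S.prm k)
            * dotNormal (mesh.normal (e, s) a) (fun d k => (u e (faceNode s a)).Fv S.prm d k) k) :=
    rfl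
  rw [h7]
  linarith

/-- The numerical value of a concentration field at a node of a side: the average at interior faces,
the local value at walls. -/
noncomputable def concentrationStar (c : Elem → Node N → ℝ) (z : Elem × Side) (a : FaceNode N) :
    ℝ :=
  match mesh.side.symm z with
  | .inl (.inl f) =>
      (c z.1 (faceNode z.2 a) + c (mesh.side (.inl (.inr f))).1
        (faceNode (mesh.side (.inl (.inr f))).2 ((mesh.orient f).nodeEquiv N a))) / 2
  | .inl (.inr f) =>
      (c (mesh.side (.inl (.inl f))).1 (faceNode (mesh.side (.inl (.inl f))).2
        (((mesh.orient f).nodeEquiv N).symm a)) + c z.1 (faceNode z.2 a)) / 2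
  | .inr _ => c z.1 (faceNode z.2 a)

/-- The numerical concentration depends linearly on the field `C` alone, so the same formula can be
applied to its time derivative. -/
theorem numericalTrace_C (S : Scheme N IFace BFace) (u : Elem → Node N → NodalData)
    (z : Elem × Side) (a : FaceNode N) : (mesh.numericalTrace S u z a).C
      = mesh.concentrationStar (fun e ν => (u e ν).C) z a := by
  obtain ⟨y, rfl⟩ := mesh.side.surjective z
  rcases y with (f | f) | g
  · simp [numericalTrace, concentrationStar, leftTrace, left, right, trace]
  · simp [numericalTrace, concentrationStar, rightTrace, left, right, trace]
  · simp [numericalTrace, concentrationStar, wallTrace, trace]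

theorem concentrationStar_add (c c' : Elem → Node N → ℝ) (z : Elem × Side) (a : FaceNode N) :
    mesh.concentrationStar (c + c') z a
      = mesh.concentrationStar c z a + mesh.concentrationStar c' z a := by
  unfold concentrationStar
  split <;> simp only [Pi.add_apply] <;> ring

theorem concentrationStar_smul (r : ℝ) (c : Elem → Node N → ℝ) (z : Elem × Side)
    (a : FaceNode N) :
    mesh.concentrationStar (r • c) z a = r * mesh.concentrationStar c z a := by
  unfold concentrationStar
  split <;> simp only [Pi.smul_apply, smul_eq_mul] <;> ring

/-- The weak gradient of a concentration field, tested with `φ`. -/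
noncomputable def weakGradient (e : Elem) (φ : Node N → Fin 3 → ℝ) :
    (Elem → Node N → ℝ) →ₗ[ℝ] ℝ where
  toFun c := mesh.boundaryIntegral e (fun s a =>
        (mesh.concentrationStar c (e, s) a - c e (faceNode s a))
          * ∑ d, φ (faceNode s a) d * mesh.normal (e, s) a d)
    + volQuad gl (fun ν => ∑ i, mesh.contra e ν i (φ ν) * refDeriv gl i (c e) ν)
  map_add' c c' := by
    have h : ∀ i ν, refDeriv gl i ((c + c') e) ν
        = refDeriv gl i (c e) ν + refDeriv gl i (c' e) ν := fun i ν => refDeriv_add gl i _ _ ν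
    simp only [concentrationStar_add, h, mul_add, Finset.sum_add_distrib, volQuad_add]
    rw [add_add_add_comm, ← boundaryIntegral_add]
    congr 2
    ext s a
    simp only [Pi.add_apply]
    ring
  map_smul' r c := by
    have h : ∀ i ν, refDeriv gl i ((r • c) e) ν = r * refDeriv gl i (c e) ν :=
      fun i ν => refDeriv_const_mul gl i r _ ν
    simp only [concentrationStar_smul, h, mul_left_comm _ r, ← Finset.mul_sum, volQuad_const_mul]
    rw [RingHom.id_apply, smul_eq_mul, mul_add, ← boundaryIntegral_const_mul]
    congr 2
    ext s a
    simp only [Pi.smul_apply, smul_eq_mul]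
    ring

theorem concentrationGradientEq_iff (S : Scheme N IFace BFace) (u : Elem → Node N → NodalData)
    (e : Elem) (φ : Node N → Fin 3 → ℝ) : mesh.ConcentrationGradientEq S u e φ ↔
      volQuad gl (fun ν => mesh.J e ν * ∑ d, (u e ν).Gc d * φ ν d)
        = mesh.weakGradient e φ (fun e ν => (u e ν).C) := by
  simp only [ConcentrationGradientEq, numericalTrace_C]
  rfl

theorem J_pos (e : Elem) (ν : Node N) : 0 < mesh.J e ν := mesh.jacobian_pos e ν

end HexMesh

end Elements

/-! ### Differentiating the discrete concentration gradient in time. -/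

section Evolution

variable {N : ℕ} {gl : GaussLobatto N} {Elem IFace BFace : Type*}
  {mesh : HexMesh gl Elem IFace BFace} {S : Scheme N IFace BFace} {T : ℝ}
  {u : ℝ → Elem → Node N → NodalData} {Qt : ℝ → Elem → Node N → Fin 5 → ℝ}

namespace HexMesh.IsSolution

theorem hasDeriv_Q (hu : mesh.IsSolution S T u Qt) {t : ℝ} (ht : t ∈ Icc 0 T) (e : Elem)
    (ν : Node N) (k : Fin 5) :
    HasDerivWithinAt (fun τ => (u τ e ν).Q k) (Qt t e ν k) (Icc 0 T) t :=
  hasDerivWithinAt_pi.1 (hu.hasDeriv t ht e ν) k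

/-- A linear functional on the finite-dimensional space of nodal values is continuous, hence
commutes with the time derivative. -/
theorem hasDeriv_weakGradient [Fintype Elem] (hu : mesh.IsSolution S T u Qt) {t : ℝ}
    (ht : t ∈ Icc 0 T) (e : Elem) (φ : Node N → Fin 3 → ℝ) :
    HasDerivWithinAt (fun τ => mesh.weakGradient e φ (fun e ν => (u τ e ν).C))
      (mesh.weakGradient e φ (fun e ν => Qt t e ν 0)) (Icc 0 T) t := by
  have h : HasDerivWithinAt (fun τ => fun e ν => (u τ e ν).C) (fun e ν => Qt t e ν 0)
      (Icc 0 T) t :=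
    hasDerivWithinAt_pi.2 fun e => hasDerivWithinAt_pi.2 fun ν => hu.hasDeriv_Q ht e ν 0
  exact (LinearMap.toContinuousLinearMap (mesh.weakGradient e φ)).hasFDerivAt.comp_hasDerivWithinAt
    t h

/-- Differentiability of `Gc` is not assumed. Testing with a nodal delta expresses each nodal value
as the weak gradient of `C` divided by a positive weight times the Jacobian. -/
theorem exists_hasDeriv_Gc [Fintype Elem] (hu : mesh.IsSolution S T u Qt) {t : ℝ}
    (ht : t ∈ Icc 0 T) (e : Elem) (ν : Node N) (d : Fin 3) :
    ∃ g, HasDerivWithinAt (fun τ => (u τ e ν).Gc d) g (Icc 0 T) t := by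
  classical
  set φ : Node N → Fin 3 → ℝ := Pi.single ν (Pi.single d 1) with hφ
  set w : ℝ := gl.weight (ν 0) * gl.weight (ν 1) * gl.weight (ν 2) * mesh.J e ν with hw
  have hw0 : w ≠ 0 := (mul_pos (mul_pos (mul_pos (gl.weight_pos _) (gl.weight_pos _))
    (gl.weight_pos _)) (mesh.J_pos e ν)).ne'
  refine ⟨_, ((hu.hasDeriv_weakGradient ht e φ).const_mul w⁻¹).congr_of_mem (fun τ hτ => ?_) ht⟩
  rw [← (mesh.concentrationGradientEq_iff S (u τ) e φ).1 (hu.concentrationGradientEq τ hτ e φ),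
    volQuad, Finset.sum_eq_single ν]
  · simp only [hφ, Pi.single_eq_same]
    rw [Finset.sum_eq_single d]
    · rw [Pi.single_eq_same, mul_one, ← mul_assoc (_ * _ * _), ← hw, inv_mul_cancel_left₀ hw0]
    · intro d' _ hd
      rw [Pi.single_eq_of_ne hd, mul_zero]
    · simp
  · intro κ _ hκ
    simp [hφ, Pi.single_eq_of_ne hκ]
  · simp

/-- The derivative in time of the discrete concentration gradient satisfies the differentiated
weak form. -/
theorem volQuad_Gc_deriv [Fintype Elem] (hu : mesh.IsSolution S T u Qt) (hT : 0 < T) {t : ℝ}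
    (ht : t ∈ Icc 0 T) (e : Elem) {Gct : Node N → Fin 3 → ℝ}
    (hG : ∀ ν d, HasDerivWithinAt (fun τ => (u τ e ν).Gc d) (Gct ν d) (Icc 0 T) t)
    (φ : Node N → Fin 3 → ℝ) :
    volQuad gl (fun ν => mesh.J e ν * ∑ d, Gct ν d * φ ν d)
      = mesh.weakGradient e φ (fun e ν => Qt t e ν 0) := by
  have h1 : HasDerivWithinAt
      (fun τ => volQuad gl (fun ν => mesh.J e ν * ∑ d, (u τ e ν).Gc d * φ ν d))
      (volQuad gl (fun ν => mesh.J e ν * ∑ d, Gct ν d * φ ν d)) (Icc 0 T) t :=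
    volQuad_hasDerivWithinAt gl fun ν =>
      (HasDerivWithinAt.fun_sum fun d _ => (hG ν d).mul_const _).const_mul _
  have h2 := (hu.hasDeriv_weakGradient ht e φ).congr_of_mem (fun τ hτ =>
    (mesh.concentrationGradientEq_iff S (u τ) e φ).1 (hu.concentrationGradientEq τ hτ e φ)) ht
  -- Derivatives within the interval are unique, also at its end points, because it is
  -- nondegenerate.
  exact (uniqueDiffOn_Icc hT t ht).eq_deriv _ h1 h2

end HexMesh.IsSolution

end Evolution
end INSCH

namespace INSCH

/-! ### The pointwise entropy and its time derivative. -/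

section Entropy

namespace NodalData

variable (prm : Params) (x : NodalData)

theorem sqrt_rho_mul_U (i : Fin 3) : Real.sqrt (x.rho prm) * x.U prm i = x.Q (spIdx i) :=
  mul_div_cancel₀ _ (Real.sqrt_pos.2 (x.rho_pos prm)).ne'

/-- Written in the state variable `√ρ U`, the kinetic energy is half a sum of squares. The cut-off
density, which need not be differentiable, drops out before any time derivative is taken. -/
theorem entropy_eq : x.entropy prm = (freeEnergy prm (x.Q 0)
    + 3 / 4 * prm.σ * prm.ε * ∑ d, x.Gc d ^ 2) + 1 / 2 * ∑ i, x.Q (spIdx i) ^ 2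
      + x.Q 4 ^ 2 / (2 * acModulus prm) := by
  have h : ∀ i, x.Q (spIdx i) ^ 2 = x.rho prm * x.U prm i ^ 2 := fun i => by
    rw [← sqrt_rho_mul_U prm, mul_pow, Real.sq_sqrt (x.rho_pos prm).le]
  simp only [h, ← Finset.mul_sum, entropy, C, P]
  ring

theorem entropy_nonneg : 0 ≤ x.entropy prm := by
  have hσ := prm.σ_pos
  have hε := prm.ε_pos
  have hm := acModulus_pos prm
  have h : freeEnergy prm (x.Q 0) = 12 * prm.σ / prm.ε * (x.Q 0 ^ 2 * (1 - x.Q 0) ^ 2) := by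
    rw [freeEnergy]; ring
  rw [entropy_eq, h]
  positivity

theorem dissipation_nonneg (h : 0 ≤ viscosity prm x.C) : 0 ≤ x.dissipation prm := by
  have hM := prm.M₀_pos
  unfold dissipation
  positivity

theorem sum_mass_mul_W (q : Fin 5 → ℝ) : ∑ k, x.mass prm k * q k * x.W prm k
    = q 0 * x.μ + ∑ i, x.Q (spIdx i) * q (spIdx i) + x.Q 4 * q 4 / acModulus prm := by
  simp only [← sqrt_rho_mul_U prm]
  simp only [mass, W, Fin.sum_univ_five, Fin.sum_univ_three, mkState_zero, mkState_one,
    mkState_two, mkState_three, mkState_four, spIdx_zero, spIdx_one, spIdx_two, P]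
  ring

end NodalData

theorem differentiable_freeEnergy (prm : Params) : Differentiable ℝ (freeEnergy prm) := by
  unfold freeEnergy
  fun_prop

/-- The derivative is arranged for the weak forms: the first sum is what the state equation
produces, and the remaining terms replace `μ` by the variation of the free energy. -/
theorem entropy_hasDerivWithinAt (prm : Params) {x : ℝ → NodalData} {q : Fin 5 → ℝ}
    {g : Fin 3 → ℝ} {s : Set ℝ} {t : ℝ}
    (hQ : ∀ k, HasDerivWithinAt (fun τ => (x τ).Q k) (q k) s t)
    (hG : ∀ d, HasDerivWithinAt (fun τ => (x τ).Gc d) (g d) s t) :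
    HasDerivWithinAt (fun τ => (x τ).entropy prm)
      (∑ k, (x t).mass prm k * q k * (x t).W prm k - (x t).μ * q 0
        + deriv (freeEnergy prm) (x t).C * q 0
        + 3 / 2 * prm.σ * prm.ε * ∑ d, g d * (x t).Gc d) s t := by
  simp only [NodalData.entropy_eq]
  have h1 : HasDerivWithinAt (fun τ => freeEnergy prm ((x τ).Q 0))
      (deriv (freeEnergy prm) ((x t).Q 0) * q 0) s t :=
    (differentiable_freeEnergy prm _).hasDerivAt.comp_hasDerivWithinAt t (hQ 0)
  have h2 := (HasDerivWithinAt.fun_sum (u := Finset.univ)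
    fun d _ => (hG d).fun_pow 2).const_mul (3 / 4 * prm.σ * prm.ε)
  have h3 := (HasDerivWithinAt.fun_sum (u := Finset.univ)
    fun i _ => (hQ (spIdx i)).fun_pow 2).const_mul (1 / 2)
  have h4 := ((hQ 4).fun_pow 2).div_const (2 * acModulus prm)
  refine (((h1.add h2).add h3).add h4).congr_deriv ?_
  have hm := (acModulus_pos prm).ne'
  rw [NodalData.sum_mass_mul_W]
  simp only [Fin.sum_univ_three, NodalData.C]
  field_simp
  ring

end Entropy

/-! ### From element balances to the global entropy balance. -/

section Balance

variable {N : ℕ} {gl : GaussLobatto N} {Elem IFace BFace : Type*}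
  {mesh : HexMesh gl Elem IFace BFace} {S : Scheme N IFace BFace} {T : ℝ}
  {u : ℝ → Elem → Node N → NodalData} {Qt : ℝ → Elem → Node N → Fin 5 → ℝ}

namespace HexMesh

/-- The sign is required only where the normal is a unit vector; it can fail to be one only at nodes
with zero surface Jacobian, which carry no weight. -/
theorem sideIntegral_nonpos (z : Elem × Side) {f : FaceNode N → ℝ}
    (h : ∀ a, ∑ n, mesh.normal z a n ^ 2 = 1 → f a ≤ 0) : mesh.sideIntegral z f ≤ 0 := by
  rw [← neg_nonneg, ← neg_one_mul, ← sideIntegral_const_mul]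
  refine faceQuad_nonneg gl fun a => ?_
  by_cases h0 : faceJacobian gl (mesh.coord z.1) z.2 a = 0
  · rw [h0, zero_mul]
  · exact mul_nonneg (faceJacobian_nonneg gl _ _ _)
      (by linarith [h a (sum_outwardNormal_sq gl _ _ _ h0)])

theorem sideIntegral_eq_zero (z : Elem × Side) {f : FaceNode N → ℝ}
    (h : ∀ a, ∑ n, mesh.normal z a n ^ 2 = 1 → f a = 0) : mesh.sideIntegral z f = 0 := by
  refine Finset.sum_eq_zero fun a _ => ?_
  beta_reduce
  by_cases h0 : faceJacobian gl (mesh.coord z.1) z.2 a = 0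
  · rw [h0, zero_mul, mul_zero]
  · rw [h a (sum_outwardNormal_sq gl _ _ _ h0), mul_zero, mul_zero]

theorem sideIntegral_nonneg (z : Elem × Side) {f : FaceNode N → ℝ}
    (h : ∀ a, 0 ≤ f a) : 0 ≤ mesh.sideIntegral z f :=
  faceQuad_nonneg gl fun a => mul_nonneg (faceJacobian_nonneg gl _ _ _) (h a)

theorem extendedEntropy_nonneg [Fintype Elem] [Fintype IFace] (hβ : ∀ f a, 0 ≤ S.β f a)
    (v : Elem → Node N → NodalData) : 0 ≤ mesh.extendedEntropy S v := by
  have hσ := S.prm.σ_pos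
  have hε := S.prm.ε_pos
  refine add_nonneg (Finset.sum_nonneg fun e _ => volQuad_nonneg gl fun ν =>
    mul_nonneg (mesh.J_pos e ν).le (NodalData.entropy_nonneg _ _)) (mul_nonneg (by positivity) ?_)
  exact Finset.sum_nonneg fun f _ => mesh.sideIntegral_nonneg _ fun a =>
    mul_nonneg (hβ f a) (sq_nonneg _)

theorem totalDissipation_nonneg [Fintype Elem] (v : Elem → Node N → NodalData)
    (h : ∀ e ν, 0 ≤ viscosity S.prm (v e ν).C) : 0 ≤ mesh.totalDissipation S v :=
  Finset.sum_nonneg fun e _ => volQuad_nonneg gl fun ν =>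
    mul_nonneg (mesh.J_pos e ν).le (NodalData.dissipation_nonneg _ _ (h e ν))

variable (mesh S) in
/-- Entropy production at the nodes of a side; `c` is the time derivative of the concentration. -/
noncomputable def sideProduction (v : Elem → Node N → NodalData) (c : Elem → Node N → ℝ)
    (z : Elem × Side) (a : FaceNode N) : ℝ :=
  boundaryProduction S.prm (trace v z a) (mesh.numericalTrace S v z a) (mesh.normal z a)
    (c z.1 (faceNode z.2 a)) (mesh.concentrationStar c z a)

/-- The entropy balance of one element. -/
theorem IsSolution.element_balance [Fintype Elem] (hu : mesh.IsSolution S T u Qt) (hT : 0 < T)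
    {t : ℝ} (ht : t ∈ Icc 0 T) (e : Elem) {Gct : Node N → Fin 3 → ℝ}
    (hG : ∀ ν d, HasDerivWithinAt (fun τ => (u τ e ν).Gc d) (Gct ν d) (Icc 0 T) t) :
    volQuad gl (fun ν => mesh.J e ν *
      (∑ k, (u t e ν).mass S.prm k * Qt t e ν k * (u t e ν).W S.prm k - (u t e ν).μ * Qt t e ν 0
        + deriv (freeEnergy S.prm) (u t e ν).C * Qt t e ν 0
        + 3 / 2 * S.prm.σ * S.prm.ε * ∑ d, Gct ν d * (u t e ν).Gc d))
    = -volQuad gl (fun ν => mesh.J e ν * (u t e ν).dissipation S.prm)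
      + mesh.boundaryIntegral e (fun s =>
        mesh.sideProduction S (u t) (fun e ν => Qt t e ν 0) (e, s)) := by
  have h1 := mesh.kinetic_balance S (u t) (Qt t) e (hu.stateEq t ht e) (hu.gradientEq t ht e)
  -- The next two identities share the volume pairing of `Gc` with the reference gradient of the
  -- time derivative of `C`, which cancels when they are combined.
  have h2 := hu.chemicalPotentialEq t ht e (fun ν => Qt t e ν 0)
  have h3 := hu.volQuad_Gc_deriv hT ht e hG (fun ν d => (u t e ν).Gc d)
  unfold ChemicalPotentialEq at h2
  simp only [weakGradient, LinearMap.coe_mk, AddHom.coe_mk] at h3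
  have hL : volQuad gl (fun ν => mesh.J e ν *
      (∑ k, (u t e ν).mass S.prm k * Qt t e ν k * (u t e ν).W S.prm k - (u t e ν).μ * Qt t e ν 0
        + deriv (freeEnergy S.prm) (u t e ν).C * Qt t e ν 0
        + 3 / 2 * S.prm.σ * S.prm.ε * ∑ d, Gct ν d * (u t e ν).Gc d))
      = volQuad gl (fun ν => mesh.J e ν *
          ∑ k, (u t e ν).mass S.prm k * Qt t e ν k * (u t e ν).W S.prm k)
        - volQuad gl (fun ν => mesh.J e ν * (u t e ν).μ * Qt t e ν 0)
        + volQuad gl (fun ν => mesh.J e ν * deriv (freeEnergy S.prm) (u t e ν).C * Qt t e ν 0)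
        + 3 / 2 * S.prm.σ * S.prm.ε
          * volQuad gl (fun ν => mesh.J e ν * ∑ d, Gct ν d * (u t e ν).Gc d) := by
    rw [← volQuad_sub, ← volQuad_add, ← volQuad_const_mul, ← volQuad_add]
    congr 1
    ext ν
    ring
  have hR : mesh.boundaryIntegral e (fun s =>
        mesh.sideProduction S (u t) (fun e ν => Qt t e ν 0) (e, s))
      = mesh.boundaryIntegral e (fun s a =>
        ∑ k, ((trace (u t) (e, s) a).W S.prm k * (mesh.numericalTrace S (u t) (e, s) a).FvN k
          + ((mesh.numericalTrace S (u t) (e, s) a).W k - (trace (u t) (e, s) a).W S.prm k)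
            * dotNormal (mesh.normal (e, s) a) ((trace (u t) (e, s) a).Fv S.prm) k))
      - mesh.boundaryIntegral e (fun s a =>
        ∑ k, (trace (u t) (e, s) a).W S.prm k * ((mesh.numericalTrace S (u t) (e, s) a).FeN k
          + (mesh.numericalTrace S (u t) (e, s) a).diamondN k
          - dotNormal (mesh.normal (e, s) a) ((trace (u t) (e, s) a).Fe S.prm) k))
      + (mesh.boundaryIntegral e (fun s a => 3 / 2 * S.prm.σ * S.prm.ε * Qt t e (faceNode s a) 0
          * (mesh.numericalTrace S (u t) (e, s) a).GcN)
        + 3 / 2 * S.prm.σ * S.prm.ε * mesh.boundaryIntegral e (fun s a =>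
          (mesh.concentrationStar (fun e ν => Qt t e ν 0) (e, s) a - Qt t e (faceNode s a) 0)
          * ∑ d, (u t e (faceNode s a)).Gc d * mesh.normal (e, s) a d)) := by
    rw [← boundaryIntegral_sub, ← boundaryIntegral_const_mul, ← boundaryIntegral_add,
      ← boundaryIntegral_add]
    congr 1
    ext s a
    simp only [sideProduction, boundaryProduction, trace]
    ring
  have hV : volQuad gl (fun ν => ∑ i, 3 / 2 * S.prm.σ * S.prm.ε
        * mesh.contra e ν i (u t e ν).Gc * refDeriv gl i (fun ν => Qt t e ν 0) ν)
      = 3 / 2 * S.prm.σ * S.prm.ε * volQuad gl (fun ν => ∑ i,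
        mesh.contra e ν i (u t e ν).Gc * refDeriv gl i (fun ν => Qt t e ν 0) ν) := by
    rw [← volQuad_const_mul]
    simp only [Finset.mul_sum, mul_assoc]
  rw [hL, hR, h1, h3, h2, hV]
  ring

/-- Seen through the gluing, both elements use the same pair of states and opposite normals, so the
pointwise computation `boundaryProduction_interior` applies. -/
theorem sideProduction_interior (v : Elem → Node N → NodalData) (c : Elem → Node N → ℝ)
    (f : IFace) (a : FaceNode N) :
    mesh.sideProduction S v c (mesh.side (.inl (.inl f))) a
      + mesh.sideProduction S v c (mesh.side (.inl (.inr f))) ((mesh.orient f).nodeEquiv N a)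
      + 3 / 2 * S.prm.σ * S.prm.ε * (S.β f a * ((mesh.right v f a).C - (mesh.left v f a).C)
        * (c (mesh.side (.inl (.inr f))).1 (faceNode (mesh.side (.inl (.inr f))).2
            ((mesh.orient f).nodeEquiv N a))
          - c (mesh.side (.inl (.inl f))).1 (faceNode (mesh.side (.inl (.inl f))).2 a)))
    = -(S.β f a * ((mesh.right v f a).μ - (mesh.left v f a).μ) ^ 2)
      - (∑ j, (mesh.left v f a).W S.prm j
          * (inviscidStar S.prm S.interiorFlux (mesh.left v f a) (mesh.right v f a)
              (mesh.normalL f a) j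
            + diamondFlux S.prm S.interiorFlux (mesh.left v f a) (mesh.right v f a)
              (mesh.left v f a) (mesh.normalL f a) j
            - dotNormal (mesh.normalL f a) ((mesh.left v f a).Fe S.prm) j)
        - ∑ j, (mesh.right v f a).W S.prm j
          * (inviscidStar S.prm S.interiorFlux (mesh.left v f a) (mesh.right v f a)
              (mesh.normalL f a) j
            + diamondFlux S.prm S.interiorFlux (mesh.left v f a) (mesh.right v f a)
              (mesh.right v f a) (mesh.normalL f a) j
            - dotNormal (mesh.normalL f a) ((mesh.right v f a).Fe S.prm) j)) := by
  rw [← boundaryProduction_interior]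
  simp only [sideProduction, numericalTrace, concentrationStar, Equiv.symm_apply_apply,
    normal_right]
  rfl

theorem sideProduction_wall (v : Elem → Node N → NodalData) (c : Elem → Node N → ℝ)
    (g : BFace) (a : FaceNode N) :
    mesh.sideProduction S v c (mesh.side (.inr g)) a
      + deriv S.fw (trace v (mesh.side (.inr g)) a).C
        * c (mesh.side (.inr g)).1 (faceNode (mesh.side (.inr g)).2 a)
    = -∑ j, (trace v (mesh.side (.inr g)) a).W S.prm j
        * (inviscidStar S.prm S.wallFlux (trace v (mesh.side (.inr g)) a)
            ((trace v (mesh.side (.inr g)) a).ghost (mesh.normal (mesh.side (.inr g)) a))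
            (mesh.normal (mesh.side (.inr g)) a) j
          + diamondFlux S.prm S.wallFlux (trace v (mesh.side (.inr g)) a)
            ((trace v (mesh.side (.inr g)) a).ghost (mesh.normal (mesh.side (.inr g)) a))
            (trace v (mesh.side (.inr g)) a) (mesh.normal (mesh.side (.inr g)) a) j
          - dotNormal (mesh.normal (mesh.side (.inr g)) a)
            ((trace v (mesh.side (.inr g)) a).Fe S.prm) j) := by
  rw [← boundaryProduction_wall S.prm S.wallFlux (S.wall g) S.fw _ _
    (c (mesh.side (.inr g)).1 (faceNode (mesh.side (.inr g)).2 a))]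
  simp only [sideProduction, numericalTrace, concentrationStar, Equiv.symm_apply_apply]

/-- The extended entropy plus the surface energy is differentiable in time; its derivative is minus
the dissipation plus the production at the faces. -/
theorem IsSolution.hasDeriv_entropy [Fintype Elem] [Fintype IFace] [Fintype BFace]
    (hu : mesh.IsSolution S T u Qt) (hfw : Differentiable ℝ S.fw) (hT : 0 < T)
    {t : ℝ} (ht : t ∈ Icc 0 T) :
    HasDerivWithinAt (fun τ => mesh.extendedEntropy S (u τ) + mesh.surfaceEnergy S (u τ))
      (-mesh.totalDissipation S (u t)
        + ∑ f, mesh.sideIntegral (mesh.side (.inl (.inl f))) (fun a =>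
          mesh.sideProduction S (u t) (fun e ν => Qt t e ν 0) (mesh.side (.inl (.inl f))) a
          + mesh.sideProduction S (u t) (fun e ν => Qt t e ν 0) (mesh.side (.inl (.inr f)))
            ((mesh.orient f).nodeEquiv N a)
          + 3 / 2 * S.prm.σ * S.prm.ε
            * (S.β f a * ((mesh.right (u t) f a).C - (mesh.left (u t) f a).C)
            * (Qt t (mesh.side (.inl (.inr f))).1 (faceNode (mesh.side (.inl (.inr f))).2
                ((mesh.orient f).nodeEquiv N a)) 0
              - Qt t (mesh.side (.inl (.inl f))).1
                (faceNode (mesh.side (.inl (.inl f))).2 a) 0)))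
        + ∑ g, mesh.sideIntegral (mesh.side (.inr g)) (fun a =>
          mesh.sideProduction S (u t) (fun e ν => Qt t e ν 0) (mesh.side (.inr g)) a
          + deriv S.fw (trace (u t) (mesh.side (.inr g)) a).C
            * Qt t (mesh.side (.inr g)).1 (faceNode (mesh.side (.inr g)).2 a) 0))
      (Icc 0 T) t := by
  choose Gct hG using fun e ν d => hu.exists_hasDeriv_Gc ht e ν d
  have hE := HasDerivWithinAt.fun_sum (u := Finset.univ) fun e _ =>
    volQuad_hasDerivWithinAt gl fun ν =>
      (entropy_hasDerivWithinAt S.prm (hu.hasDeriv_Q ht e ν) (hG e ν)).const_mul (mesh.J e ν)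
  have hC : ∀ e ν, HasDerivWithinAt (fun τ => (u τ e ν).C) (Qt t e ν 0) (Icc 0 T) t :=
    fun e ν => hu.hasDeriv_Q ht e ν 0
  have hP := (HasDerivWithinAt.fun_sum (u := Finset.univ) fun f _ =>
    mesh.sideIntegral_hasDerivWithinAt (mesh.side (.inl (.inl f))) fun a =>
      (((hC (mesh.side (.inl (.inr f))).1 (faceNode (mesh.side (.inl (.inr f))).2
          ((mesh.orient f).nodeEquiv N a))).sub
        (hC (mesh.side (.inl (.inl f))).1
          (faceNode (mesh.side (.inl (.inl f))).2 a))).fun_pow 2).const_mul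
        (S.β f a)).const_mul (3 / 4 * S.prm.σ * S.prm.ε)
  have hW := HasDerivWithinAt.fun_sum (u := Finset.univ) fun g _ =>
    mesh.sideIntegral_hasDerivWithinAt (mesh.side (.inr g)) fun a =>
      (hfw _).hasDerivAt.comp_hasDerivWithinAt t
        (hC (mesh.side (.inr g)).1 (faceNode (mesh.side (.inr g)).2 a))
  refine ((hE.add hP).add hW).congr_deriv ?_
  rw [Finset.sum_congr rfl fun e _ => hu.element_balance hT ht e (hG e)]
  rw [Finset.sum_add_distrib, mesh.sum_boundaryIntegral, Finset.sum_neg_distrib]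
  simp only [sideIntegral_add, Finset.sum_add_distrib, sideIntegral_const_mul, ← Finset.mul_sum]
  -- The factor 2 from differentiating the squared jump turns the `3/4` of the penalty energy into
  -- the `3/2` of the face production.
  have hβ : ∑ f, mesh.sideIntegral (mesh.side (.inl (.inl f))) (fun a => S.β f a *
        (((2 : ℕ) : ℝ) * ((u t (mesh.side (.inl (.inr f))).1 (faceNode
          (mesh.side (.inl (.inr f))).2 ((mesh.orient f).nodeEquiv N a))).C
            - (u t (mesh.side (.inl (.inl f))).1
              (faceNode (mesh.side (.inl (.inl f))).2 a)).C) ^ (2 - 1)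
          * (Qt t (mesh.side (.inl (.inr f))).1 (faceNode (mesh.side (.inl (.inr f))).2
                ((mesh.orient f).nodeEquiv N a)) 0
              - Qt t (mesh.side (.inl (.inl f))).1
                (faceNode (mesh.side (.inl (.inl f))).2 a) 0)))
      = 2 * ∑ f, mesh.sideIntegral (mesh.side (.inl (.inl f))) (fun a =>
        S.β f a * ((mesh.right (u t) f a).C - (mesh.left (u t) f a).C)
            * (Qt t (mesh.side (.inl (.inr f))).1 (faceNode (mesh.side (.inl (.inr f))).2
                ((mesh.orient f).nodeEquiv N a)) 0
              - Qt t (mesh.side (.inl (.inl f))).1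
                (faceNode (mesh.side (.inl (.inl f))).2 a) 0)) := by
    rw [Finset.mul_sum]
    refine Finset.sum_congr rfl fun f _ => ?_
    rw [← sideIntegral_const_mul]
    congr 1
    ext a
    simp only [right, left, trace]
    norm_num
    ring
  have hβ' := congrArg (3 / 4 * S.prm.σ * S.prm.ε * ·) hβ
  simp only [totalDissipation]
  refine Eq.trans (congrArg₂ (· + ·) (congrArg₂ (· + ·) rfl hβ') rfl) ?_
  simp only [trace]
  ring


end HexMesh

end Balance
end INSCH

/-! ### Energy inequality, equality case and monotonicity. -/

theorem mainTheorem1 {N : ℕ} {gl : INSCH.GaussLobatto N} {Elem IFace BFace : Type*}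
    [Fintype Elem] [Fintype IFace] [Fintype BFace]
    (mesh : INSCH.HexMesh gl Elem IFace BFace) (S : INSCH.Scheme N IFace BFace)
    (hβ : ∀ f a, 0 ≤ S.β f a) (hfw : Differentiable ℝ S.fw)
    (T : ℝ) (hT : 0 < T) (u : ℝ → Elem → INSCH.Node N → INSCH.NodalData)
    (Qt : ℝ → Elem → INSCH.Node N → Fin 5 → ℝ) (hu : mesh.IsSolution S T u Qt) :
    (∀ t ∈ Set.Icc 0 T, ∃ d : ℝ,
      HasDerivWithinAt (fun τ => mesh.extendedEntropy S (u τ) + mesh.surfaceEnergy S (u τ)) d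
        (Set.Icc 0 T) t ∧
      d ≤ -mesh.totalDissipation S (u t) ∧
      (S.interiorFlux = .central → S.wallFlux = .central → (∀ f a, S.β f a = 0) →
        d = -mesh.totalDissipation S (u t))) ∧
    (∀ t ∈ Set.Icc 0 T, 0 ≤ mesh.extendedEntropy S (u t)) ∧
    ((∀ t ∈ Set.Icc 0 T, ∀ e ν, 0 ≤ INSCH.viscosity S.prm (u t e ν).C) →
      ∀ t ∈ Set.Icc 0 T,
        mesh.extendedEntropy S (u t) + mesh.surfaceEnergy S (u t) ≤
          mesh.extendedEntropy S (u 0) + mesh.surfaceEnergy S (u 0)) := by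
  have main : ∀ t ∈ Set.Icc 0 T, ∃ d : ℝ,
      HasDerivWithinAt (fun τ => mesh.extendedEntropy S (u τ) + mesh.surfaceEnergy S (u τ)) d
        (Set.Icc 0 T) t ∧
      d ≤ -mesh.totalDissipation S (u t) ∧
      (S.interiorFlux = .central → S.wallFlux = .central → (∀ f a, S.β f a = 0) →
        d = -mesh.totalDissipation S (u t)) := by
    intro t ht
    refine ⟨_, hu.hasDeriv_entropy hfw hT ht, ?_, ?_⟩
    · rw [add_assoc]
      refine add_le_of_nonpos_right (add_nonpos (Finset.sum_nonpos fun f _ => ?_)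
        (Finset.sum_nonpos fun g _ => ?_))
      · refine INSCH.HexMesh.sideIntegral_nonpos _ fun a hn => ?_
        rw [mesh.sideProduction_interior (S := S) (u t) (fun e ν => Qt t e ν 0)]
        have h1 := INSCH.inviscid_interior S.prm S.interiorFlux (mesh.left (u t) f a)
          (mesh.right (u t) f a) (mesh.normalL f a) hn
        have h2 := mul_nonneg (hβ f a)
          (sq_nonneg ((mesh.right (u t) f a).μ - (mesh.left (u t) f a).μ))
        linarith
      · refine INSCH.HexMesh.sideIntegral_nonpos _ fun a hn => ?_
        rw [mesh.sideProduction_wall (S := S) (u t) (fun e ν => Qt t e ν 0)]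
        exact neg_nonpos.2 (INSCH.inviscid_wall S.prm S.wallFlux _ _ hn)
    · intro hi hw hβ0
      -- With central fluxes and no penalty the face production vanishes node by node.
      rw [add_assoc, add_eq_left, Finset.sum_eq_zero, Finset.sum_eq_zero, add_zero]
      · intro g _
        refine INSCH.HexMesh.sideIntegral_eq_zero _ fun a hn => ?_
        rw [mesh.sideProduction_wall (S := S) (u t) (fun e ν => Qt t e ν 0), hw,
          INSCH.central_wall S.prm _ _ hn, neg_zero]
      · intro f _
        refine INSCH.HexMesh.sideIntegral_eq_zero _ fun a _ => ?_
        rw [mesh.sideProduction_interior (S := S) (u t) (fun e ν => Qt t e ν 0), hi, hβ0,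
          INSCH.central_interior]
        ring
  refine ⟨main, fun t _ => INSCH.HexMesh.extendedEntropy_nonneg hβ (u t), fun hη => ?_⟩
  -- Nonnegative viscosity makes the dissipation nonnegative, so the derivative is nonpositive at
  -- interior times; continuity up to the end points then gives monotonicity on the whole interval.
  choose! d hd hle _ using main
  have hanti : AntitoneOn
      (fun τ => mesh.extendedEntropy S (u τ) + mesh.surfaceEnergy S (u τ)) (Set.Icc 0 T) := by
    refine antitoneOn_of_hasDerivWithinAt_nonpos (f' := d) (convex_Icc 0 T)
      (fun t ht => (hd t ht).continuousWithinAt)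
      (fun t ht => (hd t (interior_subset ht)).mono interior_subset) fun t ht => ?_
    have ht' := interior_subset ht
    exact (hle t ht').trans (neg_nonpos.2
      (INSCH.HexMesh.totalDissipation_nonneg (u t) (hη t ht')))
  exact fun t ht => hanti (Set.left_mem_Icc.2 hT.le) ht ht.1
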